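/- Let $p>1$ and $q>-1$. Let $(M,g)$ be a complete smooth Riemannian manifold with volume measure $dv_g$ and let $\Omega\subset M$ be open. Let $\rho\in L^1_{loc}(M)$ be such that $\rho\ge 0$ a.e. on $\Omega$, $\rho\in W^{1,p}_{loc}(\Omega)$ (with weak gradient $\nabla\rho$), and $$\rho^q|\nabla\rho|^p\in L^1_{loc}(\Omega),\qquad \rho^{p+q}\in L^1_{loc}(\Omega).$$ Assume that $\Delta_p\rho\ge 0$ on $\Omega$ in the weak sense, that is, $\rho\in L^1_{loc}(\Omega)$, $|\nabla\rho|\in L^{p-1}_{loc}(\Omega)$ and $$\int_\Omega |\nabla\rho|^{p-2}\,(\nabla\rho\cdot\nabla\varphi)\,dv_g\le 0\qquad\text{for every } 0\le\varphi\in C^1_0(\Omega).$$ Then for every $u\in C^\infty_0(\Omega)$ the functions $\rho^q|\nabla\rho|^p|u|^p$ and $\rho^{p+q}|\nabla u|^p$ are integrable on $\Omega$, and $$\left(\frac{q+1}{p}\right)^p\int_\Omega\rho^q|\nabla\rho|^p|u|^p\,dv_g\le\int_\Omega\rho^{p+q}|\nabla u|^p\,dv_g .$$ Here $C^k_0(\Omega)$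 denotes the real-valued $C^k$ functions with compact support in $\Omega$, and products with $|\nabla\rho|^p$ or $|\nabla\rho|^{p-2}\nabla\rho$ are read as $0$ where $\nabla\rho=0$. -/

import Mathlib

open MeasureTheory Set Bundle Manifold
open scoped ContDiff Topology ENNReal

noncomputable section

section Riemannian

variable {N : ℕ} {M : Type*} [TopologicalSpace M] [ChartedSpace (EuclideanSpace ℝ (Fin N)) M]

/-- The coordinate vector `∂/∂xᵢ` of the chart `e`, at the point of `M` with coordinates `y`. -/
def coordVec (e : OpenPartialHomeomorph M (EuclideanSpace ℝ (Fin N)))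
    (y : EuclideanSpace ℝ (Fin N)) (i : Fin N) : TangentSpace (𝓡 N) (e.symm y) :=
  mfderiv (𝓡 N) (𝓡 N) e.symm y
    ((EuclideanSpace.single i (1 : ℝ) : EuclideanSpace ℝ (Fin N)) : TangentSpace (𝓡 N) y)

variable [RiemannianBundle (fun x : M => TangentSpace (𝓡 N) x)]

/-- The matrix `(gᵢⱼ)` of the metric in the chart `e`, at the point with coordinates `y`. -/
def chartGram (e : OpenPartialHomeomorph M (EuclideanSpace ℝ (Fin N)))
    (y : EuclideanSpace ℝ (Fin N)) : Matrix (Fin N) (Fin N) ℝ :=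
  Matrix.of fun i j => inner ℝ (coordVec e y i) (coordVec e y j)

/-- The part of the Riemannian volume that lives on the domain of the chart `e`: the measure
`√(det gᵢⱼ) dy` on the range of the chart, carried back to `M`. -/
def chartVolume [MeasurableSpace M] (e : OpenPartialHomeomorph M (EuclideanSpace ℝ (Fin N))) :
    Measure M :=
  Measure.map e.symm
    ((volume.restrict e.target).withDensity
      fun y => ENNReal.ofReal (Real.sqrt (chartGram e y).det))

variable (N M) in
/-- The Riemannian volume measure `dv_g`. The local volumes of the charts of the atlas agree on
overlaps, and `dv_g` is the smallest measure that dominates all of them: on a second countable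
manifold it is the unique measure whose restriction to the domain of each chart `e` is
`chartVolume e`. -/
def riemannianVolume [MeasurableSpace M] : Measure M :=
  ⨆ e ∈ atlas (EuclideanSpace ℝ (Fin N)) M, chartVolume e

variable (N) in
/-- The gradient of a differentiable function: the vector that represents its differential with
respect to the Riemannian inner product. -/
def riemannianGrad (u : M → ℝ) (x : M) : TangentSpace (𝓡 N) x :=
  haveI : FiniteDimensional ℝ (TangentSpace (𝓡 N) x) :=
    inferInstanceAs (FiniteDimensional ℝ (EuclideanSpace ℝ (Fin N)))
  haveI : CompleteSpace (TangentSpace (𝓡 N) x) := FiniteDimensional.complete ℝ _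
  (InnerProductSpace.toDual ℝ (TangentSpace (𝓡 N) x)).symm
    (mfderiv (𝓡 N) 𝓘(ℝ, ℝ) u x : TangentSpace (𝓡 N) x →L[ℝ] ℝ)

/-- `V` is the weak gradient of `ρ` on the open set `Ω`: in each chart `e`, the function `ρ` and
the covariant components `⟪V, ∂ᵢ⟫` of `V` are locally integrable, and `⟪V, ∂ᵢ⟫` is the `i`-th weak
partial derivative of `ρ`, on the image of `Ω` in that chart. -/
def IsWeakGrad (Ω : Set M) (ρ : M → ℝ) (V : ∀ x : M, TangentSpace (𝓡 N) x) : Prop :=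
  ∀ e ∈ atlas (EuclideanSpace ℝ (Fin N)) M,
    LocallyIntegrableOn (fun y => ρ (e.symm y)) (e.target ∩ e.symm ⁻¹' Ω) volume ∧
    ∀ i : Fin N,
      LocallyIntegrableOn (fun y => inner ℝ (V (e.symm y)) (coordVec e y i))
        (e.target ∩ e.symm ⁻¹' Ω) volume ∧
      ∀ ψ : EuclideanSpace ℝ (Fin N) → ℝ, ContDiff ℝ ∞ ψ → HasCompactSupport ψ →
        tsupport ψ ⊆ e.target ∩ e.symm ⁻¹' Ω →
        ∫ y in e.target ∩ e.symm ⁻¹' Ω,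
            ρ (e.symm y) * fderiv ℝ ψ y (EuclideanSpace.single i (1 : ℝ)) =
          -∫ y in e.target ∩ e.symm ⁻¹' Ω,
            inner ℝ (V (e.symm y)) (coordVec e y i) * ψ y

/-- `ρ ∈ W^{1,p}_loc(Ω)`, with weak gradient `V`. -/
structure MemSobolevLoc [MeasurableSpace M] (p : ℝ) (Ω : Set M) (ρ : M → ℝ)
    (V : ∀ x : M, TangentSpace (𝓡 N) x) : Prop where
  isWeakGrad : IsWeakGrad Ω ρ V
  locallyIntegrableOn :
    LocallyIntegrableOn (fun x => |ρ x| ^ p) Ω (riemannianVolume N M)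
  locallyIntegrableOn_grad :
    LocallyIntegrableOn (fun x => ‖V x‖ ^ p) Ω (riemannianVolume N M)

/-- `ρ`, with weak gradient `V`, satisfies `Δ_p ρ ≥ 0` on `Ω` in the weak sense: `ρ ∈ L¹_loc(Ω)`,
`|∇ρ| ∈ L^{p-1}_loc(Ω)`, and `∫_Ω |∇ρ|^{p-2} ∇ρ · ∇φ ≤ 0` for all nonnegative `φ ∈ C¹_0(Ω)`. -/
structure IsPSubharmonic [MeasurableSpace M] (p : ℝ) (Ω : Set M) (ρ : M → ℝ)
    (V : ∀ x : M, TangentSpace (𝓡 N) x) : Prop where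
  isWeakGrad : IsWeakGrad Ω ρ V
  locallyIntegrableOn : LocallyIntegrableOn ρ Ω (riemannianVolume N M)
  locallyIntegrableOn_grad :
    LocallyIntegrableOn (fun x => ‖V x‖ ^ (p - 1)) Ω (riemannianVolume N M)
  integral_nonpos : ∀ φ : M → ℝ, ContMDiff (𝓡 N) 𝓘(ℝ, ℝ) 1 φ → HasCompactSupport φ →
    tsupport φ ⊆ Ω → (∀ x, 0 ≤ φ x) →
    ∫ x in Ω, ‖V x‖ ^ (p - 2) * inner ℝ (V x) (riemannianGrad N φ x) ∂(riemannianVolume N M) ≤ 0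

end Riemannian

end

open Filter
open scoped Convolution

/-! Formally, test `Δ_p ρ ≥ 0` with `φ = ρ^(q+1) |u|^p`. This gives `(q+1) ∫ ρ^q |∇ρ|^p |u|^p ≤ p ∫
ρ^(q+1) |∇ρ|^(p-1) |u|^(p-1) |∇u|`. Write `X` and `Y` for the two integrals of the theorem and `c =
(q+1)/p`. Young's inequality with weight `c` (`hardy_young`) bounds the right side by `(p-1) c X +
c^(1-p) Y`. Since `X` is finite and `q+1 = pc`, what remains is `c X ≤ c^(1-p) Y`, that is `c^p X ≤
Y`.

The work lies in justifying the test function, which is neither `C¹` nor bounded. The power is first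
replaced by a `C¹` function `f` with bounded derivative, nonnegative on `[0,∞)`, and `|u|^p` by any
nonnegative `w ∈ C¹_0(Ω)`. In a chart `ρ` is mollified to `ρ_ε`, so `w f(ρ_ε)` is admissible. The
limit `ε → 0` (`integral_chain_nonpos`) pairs `|∇ρ|^(p-2) ∇ρ`, locally in the conjugate Lebesgue
space, with `∇ρ_ε`.

The inequality obtained is linear in `w`, so a partition of unity spreads it over the manifold
(`integral_chain_nonpos_manifold`). Finally `f` increases to the power through truncations dominated
by `t^(q+1)`, with derivatives dominated by `(q+1) t^q` (`exists_contDiff_tendsto_rpow`). The Young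
bound on the cross term is then an integrable majorant, and dominated convergence applies. -/

/-! ### A limit theorem and a form of Young's inequality -/

/-- Fatou's lemma applied to `g n + h n ≥ 0`: its integral is at most `∫ g'` for large `n`, hence `∫
(g' + h') ≤ ∫ g'`. The majorant may vary with `n`, as it does under mollification. -/
theorem integral_nonpos_of_tendsto_of_abs_le {α : Type*} [MeasurableSpace α] {μ : Measure α}
    {h g : ℕ → α → ℝ} {h' g' : α → ℝ}
    (hh : ∀ᵐ x ∂μ, Tendsto (fun n => h n x) atTop (𝓝 (h' x)))
    (hg : ∀ᵐ x ∂μ, Tendsto (fun n => g n x) atTop (𝓝 (g' x)))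
    (hle : ∀ n x, |h n x| ≤ g n x) (hhi : ∀ n, AEStronglyMeasurable (h n) μ)
    (hgi : ∀ n, Integrable (g n) μ) (hgi' : Integrable g' μ)
    (hint : ∀ n, ∫ x, g n x ∂μ = ∫ x, g' x ∂μ) (hneg : ∀ᶠ n in atTop, ∫ x, h n x ∂μ ≤ 0) :
    Integrable h' μ ∧ ∫ x, h' x ∂μ ≤ 0 := by
  have hhn : ∀ n, Integrable (h n) μ := fun n =>
    (hgi n).mono' (hhi n) (Eventually.of_forall fun x => hle n x)
  have hle' : ∀ᵐ x ∂μ, |h' x| ≤ g' x := by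
    filter_upwards [hh, hg] with x hx hx'
    exact le_of_tendsto_of_tendsto' hx.abs hx' fun n => hle n x
  have hm' : AEStronglyMeasurable h' μ := aestronglyMeasurable_of_tendsto_ae atTop hhi hh
  have hi' : Integrable h' μ := hgi'.mono' hm' hle'
  refine ⟨hi', ?_⟩
  have h0 : ∀ n x, 0 ≤ g n x + h n x := fun n x => by linarith [neg_abs_le (h n x), hle n x]
  have h0' : 0 ≤ᵐ[μ] fun x => g' x + h' x := by
    filter_upwards [hle'] with x hx
    change 0 ≤ _
    linarith [neg_abs_le (h' x)]
  have hG : 0 ≤ ∫ x, g' x ∂μ := integral_nonneg_of_ae (by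
    filter_upwards [hle'] with x hx using (abs_nonneg _).trans hx)
  have key : ∫⁻ x, ENNReal.ofReal (g' x + h' x) ∂μ ≤ ENNReal.ofReal (∫ x, g' x ∂μ) := by
    calc ∫⁻ x, ENNReal.ofReal (g' x + h' x) ∂μ
        = ∫⁻ x, liminf (fun n => ENNReal.ofReal (g n x + h n x)) atTop ∂μ := by
          refine lintegral_congr_ae ?_
          filter_upwards [hh, hg] with x hx hx'
          exact ((ENNReal.continuous_ofReal.tendsto _).comp (hx'.add hx)).liminf_eq.symm
      _ ≤ liminf (fun n => ∫⁻ x, ENNReal.ofReal (g n x + h n x) ∂μ) atTop :=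
          lintegral_liminf_le' fun n =>
            ((hgi n).aestronglyMeasurable.aemeasurable.add (hhi n).aemeasurable).ennreal_ofReal
      _ ≤ ENNReal.ofReal (∫ x, g' x ∂μ) := by
          refine liminf_le_of_le (by isBoundedDefault) fun b hb => ?_
          obtain ⟨n, hn, hn'⟩ := (hb.and hneg).exists
          have hadd : Integrable (fun x => g n x + h n x) μ := (hgi n).add (hhn n)
          refine hn.trans ?_
          rw [← ofReal_integral_eq_lintegral_ofReal hadd
            (Eventually.of_forall (h0 n))]
          refine ENNReal.ofReal_le_ofReal ?_
          rw [integral_add (hgi n) (hhn n), hint n]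
          linarith
  have hadd' : Integrable (fun x => g' x + h' x) μ := hgi'.add hi'
  rw [← ofReal_integral_eq_lintegral_ofReal hadd' h0', ENNReal.ofReal_le_ofReal_iff hG]
    at key
  rw [integral_add hgi' hi'] at key
  linarith

/-- The graph of the convex function `t ↦ t ^ p` lies above its tangent line at `m`. -/
theorem rpow_sub_one_mul_le {p m a : ℝ} (hp : 1 < p) (hm : 0 ≤ m) (ha : 0 ≤ a) :
    p * m ^ (p - 1) * a ≤ (p - 1) * m ^ p + a ^ p := by
  have hq := Real.HolderConjugate.conjExponent hp
  set q := Real.conjExponent p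
  have := Real.young_inequality_of_nonneg ha (Real.rpow_nonneg hm (p - 1)) hq
  rw [← Real.rpow_mul hm, hq.sub_one_mul_conj] at this
  have e : p / q = p - 1 := by rw [hq.div_conj_eq_sub_one]
  have hp0 : 0 < p := hq.pos
  calc p * m ^ (p - 1) * a = p * (a * m ^ (p - 1)) := by ring
    _ ≤ p * (a ^ p / p + m ^ p / q) := by gcongr
    _ = a ^ p + (p / q) * m ^ p := by field_simp
    _ = _ := by rw [e]; ring

/-! ### Mollification -/

section Mollify

variable {E : Type*} [NormedAddCommGroup E] [NormedSpace ℝ E] [FiniteDimensional ℝ E]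
  [MeasurableSpace E] [BorelSpace E] {μ : Measure E} [μ.IsAddHaarMeasure]

/-- Jensen's inequality for the probability density `φ`, obtained by integrating the tangent line
inequality at the mean `m` of `|g|`. -/
theorem abs_convolution_rpow_le {φ g : E → ℝ} (hφ : Continuous φ) (hφc : HasCompactSupport φ)
    (hφ0 : ∀ x, 0 ≤ φ x) (hφ1 : ∫ x, φ x ∂μ = 1) {p : ℝ} (hp : 1 < p)
    (hg : LocallyIntegrable g μ) (hgp : LocallyIntegrable (fun x => |g x| ^ p) μ) (x : E) :
    |(φ ⋆[ContinuousLinearMap.lsmul ℝ ℝ, μ] g) x| ^ p ≤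
      (φ ⋆[ContinuousLinearMap.lsmul ℝ ℝ, μ] fun y => |g y| ^ p) x := by
  have i1 : Integrable (fun t => φ t * g (x - t)) μ :=
    hφc.convolutionExists_left (ContinuousLinearMap.lsmul ℝ ℝ) hφ hg x
  have i2 : Integrable (fun t => φ t * |g (x - t)| ^ p) μ :=
    hφc.convolutionExists_left (ContinuousLinearMap.lsmul ℝ ℝ) hφ hgp x
  have i3 : Integrable (fun t => φ t * |g (x - t)|) μ := by
    refine i1.abs.congr (Eventually.of_forall fun t => ?_)
    simp only [abs_mul, abs_of_nonneg (hφ0 t)]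
  have i0 : Integrable φ μ := hφ.integrable_of_hasCompactSupport hφc
  simp only [convolution_lsmul, smul_eq_mul]
  set m := ∫ t, φ t * |g (x - t)| ∂μ with hm
  have hm0 : 0 ≤ m := integral_nonneg fun t => mul_nonneg (hφ0 t) (abs_nonneg _)
  have h1 : |∫ t, φ t * g (x - t) ∂μ| ≤ m := by
    refine (abs_integral_le_integral_abs).trans_eq (integral_congr_ae (Eventually.of_forall ?_))
    intro t
    simp only [abs_mul, abs_of_nonneg (hφ0 t)]
  refine (Real.rpow_le_rpow (abs_nonneg _) h1 (by linarith)).trans ?_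
  have h2 : ∫ t, p * m ^ (p - 1) * (φ t * |g (x - t)|) ∂μ ≤
      ∫ t, ((p - 1) * m ^ p * φ t + φ t * |g (x - t)| ^ p) ∂μ := by
    refine integral_mono (i3.const_mul _) ((i0.const_mul _).add i2) fun t => ?_
    have := mul_le_mul_of_nonneg_left (rpow_sub_one_mul_le hp hm0 (abs_nonneg (g (x - t)))) (hφ0 t)
    dsimp only
    linarith
  rw [integral_const_mul, integral_add (i0.const_mul _) i2, integral_const_mul, hφ1, ← hm] at h2
  have h3 : m ^ (p - 1) * m = m ^ p := by
    rcases hm0.eq_or_lt with h | h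
    · rw [← h, Real.zero_rpow (by linarith : p ≠ 0)]; simp
    · rw [← Real.rpow_add_one h.ne']; ring_nf
  have h4 : p * m ^ (p - 1) * m = p * m ^ p := by rw [mul_assoc, h3]
  linarith

variable (μ) in
/-- The convolution of `g` with the normalized bump function `φ`. -/
noncomputable def mollify (φ : ContDiffBump (0 : E)) (g : E → ℝ) : E → ℝ :=
  φ.normed μ ⋆[ContinuousLinearMap.lsmul ℝ ℝ, μ] g

theorem contDiff_mollify (φ : ContDiffBump (0 : E)) {g : E → ℝ} (hg : LocallyIntegrable g μ) :
    ContDiff ℝ 1 (mollify μ φ g) :=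
  φ.hasCompactSupport_normed.contDiff_convolution_left (n := 1) _ φ.contDiff_normed hg

theorem mollify_nonneg (φ : ContDiffBump (0 : E)) {g : E → ℝ} (hg : ∀ᵐ x ∂μ, 0 ≤ g x) (x : E) :
    0 ≤ mollify μ φ g x := by
  rw [mollify, convolution_lsmul_swap]
  refine integral_nonneg_of_ae ?_
  filter_upwards [hg] with t ht
  exact mul_nonneg (φ.nonneg_normed _) ht

theorem abs_mollify_rpow_le (φ : ContDiffBump (0 : E)) {p : ℝ} (hp : 1 < p) {g : E → ℝ}
    (hg : LocallyIntegrable g μ) (hgp : LocallyIntegrable (fun x => |g x| ^ p) μ) (x : E) :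
    |mollify μ φ g x| ^ p ≤ mollify μ φ (fun y => |g y| ^ p) x :=
  abs_convolution_rpow_le φ.continuous_normed φ.hasCompactSupport_normed φ.nonneg_normed
    φ.integral_normed hp hg hgp x

theorem integrable_mollify (φ : ContDiffBump (0 : E)) {g : E → ℝ} (hg : Integrable g μ) :
    Integrable (mollify μ φ g) μ :=
  φ.integrable_normed.integrable_convolution _ hg

theorem integral_mollify (φ : ContDiffBump (0 : E)) {g : E → ℝ} (hg : Integrable g μ) :
    ∫ x, mollify μ φ g x ∂μ = ∫ x, g x ∂μ := by
  have := integral_convolution (ContinuousLinearMap.lsmul ℝ ℝ)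
    (φ.integrable_normed (μ := μ)) hg
  rw [φ.integral_normed] at this
  simpa [mollify] using this

/-- The derivative falls on the kernel, and `t ↦ φ (x - t)` serves as test function. Testing only
inside the closed ball around `x` is enough, so `d` need be the weak derivative of `g` only near
`x`. -/
theorem fderiv_mollify_apply (φ : ContDiffBump (0 : E)) {g d : E → ℝ}
    (hg : LocallyIntegrable g μ) (x v : E)
    (hweak : ∀ ψ : E → ℝ, ContDiff ℝ ∞ ψ → HasCompactSupport ψ →
      tsupport ψ ⊆ Metric.closedBall x φ.rOut →
      ∫ y, g y * fderiv ℝ ψ y v ∂μ = -∫ y, d y * ψ y ∂μ) :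
    fderiv ℝ (mollify μ φ g) x v = mollify μ φ d x := by
  have h1 := (φ.hasCompactSupport_normed (μ := μ)).hasFDerivAt_convolution_left
    (ContinuousLinearMap.lsmul ℝ ℝ) φ.contDiff_normed hg x
  have hex := ((φ.hasCompactSupport_normed (μ := μ)).fderiv (𝕜 := ℝ)).convolutionExists_left
    ((ContinuousLinearMap.lsmul ℝ ℝ).precompL E)
    ((φ.contDiff_normed (μ := μ) (n := 1)).continuous_fderiv one_ne_zero) hg x
  have h2 : fderiv ℝ (mollify μ φ g) x v = ∫ t, fderiv ℝ (φ.normed μ) (x - t) v * g t ∂μ := by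
    rw [mollify, h1.fderiv, convolution_eq_swap,
      ContinuousLinearMap.integral_apply hex.integrable_swap]
    refine integral_congr_ae (Eventually.of_forall fun t => ?_)
    simp [ContinuousLinearMap.precompL_apply]
  have hψd : ∀ y, fderiv ℝ (fun t => φ.normed μ (x - t)) y v = -fderiv ℝ (φ.normed μ) (x - y) v := by
    intro y
    have hd : HasFDerivAt (φ.normed μ) (fderiv ℝ (φ.normed μ) (x - y)) (x - y) :=
      ((φ.contDiff_normed (μ := μ) (n := 1)).differentiable one_ne_zero _).hasFDerivAt
    have := hd.comp y ((hasFDerivAt_id y).const_sub x)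
    rw [show (fun t => φ.normed μ (x - t)) = φ.normed μ ∘ HSub.hSub x from rfl, this.fderiv]
    simp
  have hsub : tsupport (fun t => φ.normed μ (x - t)) ⊆ Metric.closedBall x φ.rOut := by
    refine closure_minimal (fun t ht => ?_) Metric.isClosed_closedBall
    have : x - t ∈ Function.support (φ.normed μ) := ht
    rw [φ.support_normed_eq, mem_ball_zero_iff] at this
    rw [Metric.mem_closedBall, dist_comm, dist_eq_norm]
    exact this.le
  have h3 := hweak (fun t => φ.normed μ (x - t))
    ((φ.contDiff_normed (n := ⊤)).comp (contDiff_const.sub contDiff_id))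
    (HasCompactSupport.of_support_subset_isCompact (isCompact_closedBall x φ.rOut)
      (subset_closure.trans hsub)) hsub
  rw [h2, mollify, convolution_lsmul_swap]
  simp only [hψd, smul_eq_mul] at h3 ⊢
  rw [← neg_inj, ← integral_neg]
  simp only [mul_comm (d _)] at h3
  rw [← h3]
  refine integral_congr_ae (Eventually.of_forall fun t => ?_)
  simp only
  ring

end Mollify

/-! ### The tested inequality in a vector space -/

theorem mul_le_rpow_add_rpow {p q a b : ℝ} (h : p.HolderConjugate q) (ha : 0 ≤ a) (hb : 0 ≤ b) :
    a * b ≤ a ^ p + b ^ q :=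
  (Real.young_inequality_of_nonneg ha hb h).trans
    (add_le_add (div_le_self (Real.rpow_nonneg ha _) h.lt.le)
      (div_le_self (Real.rpow_nonneg hb _) h.symm.lt.le))

theorem abs_le_add_mul_abs_of_deriv_le {f : ℝ → ℝ} (hf : ContDiff ℝ 1 f) {L : ℝ}
    (hL : ∀ t, |deriv f t| ≤ L) (t : ℝ) : |f t| ≤ |f 0| + L * |t| := by
  have := Convex.norm_image_sub_le_of_norm_deriv_le (f := f) (x := 0) (y := t) (C := L)
    (fun x _ => hf.differentiable one_ne_zero x) (fun x _ => hL x) convex_univ (mem_univ _)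
    (mem_univ _)
  simp only [sub_zero, Real.norm_eq_abs] at this
  have h2 := abs_sub_abs_le_abs_sub (f t) (f 0)
  linarith

section Mollify

variable {E : Type*} [NormedAddCommGroup E] [NormedSpace ℝ E] [FiniteDimensional ℝ E]
  [MeasurableSpace E] [BorelSpace E] {μ : Measure E} [μ.IsAddHaarMeasure]

theorem tendsto_mollify {φ : ℕ → ContDiffBump (0 : E)}
    (hφ : Tendsto (fun n => (φ n).rOut) atTop (𝓝 0)) (hφ' : ∀ n, (φ n).rOut ≤ 2 * (φ n).rIn)
    {g : E → ℝ} (hg : LocallyIntegrable g μ) :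
    ∀ᵐ x ∂μ, Tendsto (fun n => mollify μ (φ n) g x) atTop (𝓝 (g x)) :=
  ContDiffBump.ae_convolution_tendsto_right_of_locallyIntegrable hφ (Eventually.of_forall hφ') hg

/-- The limit of vanishing mollification. Here `q` is the conjugate exponent of `p`, not the
exponent of the Hardy inequality. Young splits each product of `|B i|` with a mollified function,
and Jensen moves the power `p` under the mollification. The resulting majorant has an integral
independent of `n`, because mollification preserves integrals. -/
theorem integral_chain_nonpos_of_mollify_nonpos {φ : ℕ → ContDiffBump (0 : E)}
    (hφ : Tendsto (fun n => (φ n).rOut) atTop (𝓝 0)) (hφ' : ∀ n, (φ n).rOut ≤ 2 * (φ n).rIn)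
    {ι : Type*} [Fintype ι] {p q : ℝ} (hpq : p.HolderConjugate q)
    {r : E → ℝ} {D B : ι → E → ℝ} (hr : Integrable r μ) (hrp : Integrable (fun x => |r x| ^ p) μ)
    (hD : ∀ i, Integrable (D i) μ) (hDp : ∀ i, Integrable (fun x => |D i x| ^ p) μ)
    (hB : ∀ i, Integrable (B i) μ) (hBq : ∀ i, Integrable (fun x => |B i x| ^ q) μ)
    {f : ℝ → ℝ} (hf : ContDiff ℝ 1 f) {L : ℝ} (hL : ∀ t, |deriv f t| ≤ L)
    {w : E → ℝ} {w' : ι → E → ℝ} (hw : Continuous w) (hw' : ∀ i, Continuous (w' i)) {W : ℝ}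
    (hwW : ∀ x, |w x| ≤ W) (hwW' : ∀ i x, |w' i x| ≤ W)
    (hneg : ∀ᶠ n in atTop, ∫ x, ∑ i, B i x * (f (mollify μ (φ n) r x) * w' i x +
      w x * (deriv f (mollify μ (φ n) r x) * mollify μ (φ n) (D i) x)) ∂μ ≤ 0) :
    Integrable (fun x => ∑ i, B i x * (f (r x) * w' i x + w x * (deriv f (r x) * D i x))) μ ∧
      ∫ x, ∑ i, B i x * (f (r x) * w' i x + w x * (deriv f (r x) * D i x)) ∂μ ≤ 0 := by
  have hL0 : 0 ≤ L := (abs_nonneg _).trans (hL 0)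
  have hW0 : 0 ≤ W := (abs_nonneg _).trans (hwW 0)
  have hf' : Continuous (deriv f) := hf.continuous_deriv le_rfl
  -- The majorant, with `R` and `Q i` standing for `|r| ^ p` and `|D i| ^ p` or for their
  -- mollifications.
  set S : (E → ℝ) → (ι → E → ℝ) → E → ℝ := fun R Q x =>
    ∑ i, (W * |f 0| * |B i x| + W * L * (2 * |B i x| ^ q + (R x + Q i x))) with hS
  have hSi₁ : ∀ (R : E → ℝ) (Q : ι → E → ℝ), Integrable R μ → (∀ i, Integrable (Q i) μ) → ∀ i, Integrable (fun x =>
      W * |f 0| * |B i x| + W * L * (2 * |B i x| ^ q + (R x + Q i x))) μ := fun R Q hR hQ i =>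
    ((hB i).abs.const_mul _).add ((((hBq i).const_mul _).add (hR.add (hQ i))).const_mul _)
  have hSi : ∀ R Q, Integrable R μ → (∀ i, Integrable (Q i) μ) → Integrable (S R Q) μ :=
    fun R Q hR hQ => integrable_finsetSum _ fun i _ => hSi₁ R Q hR hQ i
  have hSint : ∀ R Q, Integrable R μ → (∀ i, Integrable (Q i) μ) → ∫ x, S R Q x ∂μ =
      ∑ i, (W * |f 0| * ∫ x, |B i x| ∂μ +
        W * L * (2 * ∫ x, |B i x| ^ q ∂μ + (∫ x, R x ∂μ + ∫ x, Q i x ∂μ))) := by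
    intro R Q hR hQ
    rw [hS, integral_finsetSum _ fun i _ => hSi₁ R Q hR hQ i]
    refine Finset.sum_congr rfl fun i _ => ?_
    have h1 : Integrable (fun x => R x + Q i x) μ := hR.add (hQ i)
    have h2 : Integrable (fun x => 2 * |B i x| ^ q + (R x + Q i x)) μ :=
      ((hBq i).const_mul _).add h1
    rw [integral_add ((hB i).abs.const_mul _) (h2.const_mul _), integral_const_mul,
      integral_const_mul, integral_add ((hBq i).const_mul _) h1, integral_const_mul,
      integral_add hR (hQ i)]
  refine integral_nonpos_of_tendsto_of_abs_le
    (h := fun n x => ∑ i, B i x * (f (mollify μ (φ n) r x) * w' i x +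
      w x * (deriv f (mollify μ (φ n) r x) * mollify μ (φ n) (D i) x)))
    (g := fun n => S (mollify μ (φ n) fun x => |r x| ^ p)
      fun i => mollify μ (φ n) fun x => |D i x| ^ p)
    (g' := S (fun x => |r x| ^ p) fun i x => |D i x| ^ p) ?_ ?_ ?_ ?_ ?_ ?_ ?_ hneg
  · have hDt : ∀ᵐ x ∂μ, ∀ i, Tendsto (fun n => mollify μ (φ n) (D i) x) atTop (𝓝 (D i x)) :=
      ae_all_iff.2 fun i => tendsto_mollify hφ hφ' (hD i).locallyIntegrable
    filter_upwards [hDt, tendsto_mollify hφ hφ' hr.locallyIntegrable] with x hx hx'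
    refine tendsto_finsetSum _ fun i _ => (Tendsto.const_mul _ ?_)
    exact (((hf.continuous.tendsto _).comp hx').mul_const _).add
      ((((hf'.tendsto _).comp hx').mul (hx i)).const_mul _)
  · have hDt : ∀ᵐ x ∂μ, ∀ i, Tendsto (fun n => mollify μ (φ n) (fun y => |D i y| ^ p) x) atTop
        (𝓝 (|D i x| ^ p)) :=
      ae_all_iff.2 fun i => tendsto_mollify hφ hφ' (hDp i).locallyIntegrable
    filter_upwards [hDt, tendsto_mollify hφ hφ' hrp.locallyIntegrable] with x hx hx'
    exact tendsto_finsetSum _ fun i _ => tendsto_const_nhds.add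
      ((tendsto_const_nhds.add (hx'.add (hx i))).const_mul _)
  · intro n x
    refine (Finset.abs_sum_le_sum_abs _ _).trans (Finset.sum_le_sum fun i _ => ?_)
    have hR := abs_mollify_rpow_le (φ n) hpq.lt hr.locallyIntegrable hrp.locallyIntegrable x
    have hQ := abs_mollify_rpow_le (φ n) hpq.lt (hD i).locallyIntegrable
      (hDp i).locallyIntegrable x
    set R := mollify μ (φ n) r x
    set Q := mollify μ (φ n) (D i) x
    have y1 := mul_le_rpow_add_rpow hpq (abs_nonneg R) (abs_nonneg (B i x))
    have y2 := mul_le_rpow_add_rpow hpq (abs_nonneg Q) (abs_nonneg (B i x))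
    have e1 : |f R * w' i x + w x * (deriv f R * Q)| ≤ (|f 0| + L * |R|) * W + W * (L * |Q|) := by
      refine (abs_add_le _ _).trans (add_le_add ?_ ?_)
      · rw [abs_mul]
        exact mul_le_mul (abs_le_add_mul_abs_of_deriv_le hf hL R) (hwW' i x) (abs_nonneg _)
          (by positivity)
      · rw [abs_mul, abs_mul]
        exact mul_le_mul (hwW x) (mul_le_mul_of_nonneg_right (hL _) (abs_nonneg _))
          (by positivity) hW0
    rw [abs_mul]
    calc |B i x| * |f R * w' i x + w x * (deriv f R * Q)|
        ≤ |B i x| * ((|f 0| + L * |R|) * W + W * (L * |Q|)) := by gcongr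
      _ = W * |f 0| * |B i x| + W * L * (|R| * |B i x| + |Q| * |B i x|) := by ring
      _ ≤ W * |f 0| * |B i x| + W * L * ((|R| ^ p + |B i x| ^ q) + (|Q| ^ p + |B i x| ^ q)) := by
          gcongr
      _ ≤ W * |f 0| * |B i x| + W * L * ((mollify μ (φ n) (fun x => |r x| ^ p) x + |B i x| ^ q) +
            (mollify μ (φ n) (fun x => |D i x| ^ p) x + |B i x| ^ q)) := by
          gcongr
      _ = _ := by ring
  · intro n
    have c1 := (contDiff_mollify (φ n) hr.locallyIntegrable).continuous
    refine Finset.aestronglyMeasurable_fun_sum _ fun i _ =>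
      (hB i).aestronglyMeasurable.mul (Continuous.aestronglyMeasurable ?_)
    have c2 := (contDiff_mollify (φ n) (hD i).locallyIntegrable).continuous
    exact ((hf.continuous.comp c1).mul (hw' i)).add (hw.mul ((hf'.comp c1).mul c2))
  · exact fun n => hSi _ _ (integrable_mollify _ hrp) fun i => integrable_mollify _ (hDp i)
  · exact hSi _ _ hrp hDp
  · intro n
    rw [hSint _ _ (integrable_mollify _ hrp) fun i => integrable_mollify _ (hDp i),
      hSint _ _ hrp hDp]
    simp only [integral_mollify _ hrp, integral_mollify _ (hDp _)]

/-- The test function is `w * f (R)` with `R` a mollification of `r`; it is nonnegative because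
mollification preserves `r ≥ 0`. In the application `B` is the vector field `|∇ρ|^(p-2) ∇ρ` times
the volume density. -/
theorem integral_chain_nonpos {U : Set E} (hU : IsOpen U)
    {ι : Type*} [Fintype ι] {b : ι → E} {p q : ℝ} (hpq : p.HolderConjugate q)
    {r : E → ℝ} {D B : ι → E → ℝ} (hr0 : ∀ᵐ x ∂μ.restrict U, 0 ≤ r x)
    (hr : LocallyIntegrableOn r U μ) (hrp : LocallyIntegrableOn (fun x => |r x| ^ p) U μ)
    (hD : ∀ i, LocallyIntegrableOn (D i) U μ)
    (hDp : ∀ i, LocallyIntegrableOn (fun x => |D i x| ^ p) U μ)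
    (hB : ∀ i, LocallyIntegrableOn (B i) U μ)
    (hBq : ∀ i, LocallyIntegrableOn (fun x => |B i x| ^ q) U μ)
    (hweak : ∀ i, ∀ ψ : E → ℝ, ContDiff ℝ ∞ ψ → HasCompactSupport ψ → tsupport ψ ⊆ U →
      ∫ y in U, r y * fderiv ℝ ψ y (b i) ∂μ = -∫ y in U, D i y * ψ y ∂μ)
    (hsub : ∀ φ : E → ℝ, ContDiff ℝ 1 φ → HasCompactSupport φ → tsupport φ ⊆ U → (∀ x, 0 ≤ φ x) →
      ∫ x in U, ∑ i, B i x * fderiv ℝ φ x (b i) ∂μ ≤ 0)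
    {f : ℝ → ℝ} (hf : ContDiff ℝ 1 f) (hf0 : ∀ t, 0 ≤ t → 0 ≤ f t) {L : ℝ}
    (hL : ∀ t, |deriv f t| ≤ L)
    {w : E → ℝ} (hw : ContDiff ℝ 1 w) (hwc : HasCompactSupport w) (hwU : tsupport w ⊆ U)
    (hw0 : ∀ x, 0 ≤ w x) :
    IntegrableOn (fun x => ∑ i, B i x * (f (r x) * fderiv ℝ w x (b i) +
        w x * (deriv f (r x) * D i x))) U μ ∧
      ∫ x in U, ∑ i, B i x * (f (r x) * fderiv ℝ w x (b i) +
        w x * (deriv f (r x) * D i x)) ∂μ ≤ 0 := by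
  obtain ⟨δ, hδ, hδU⟩ := hwc.isCompact.exists_cthickening_subset_open hU hwU
  -- Cutting all data off outside `K` makes them globally integrable. On the support of `w`,
  -- mollification at scale below `δ` does not see the cut.
  set K := Metric.cthickening δ (tsupport w) with hK
  have hKc : IsCompact K := hwc.isCompact.cthickening
  have hKm : MeasurableSet K := hKc.measurableSet
  have hwK : tsupport w ⊆ K := Metric.self_subset_cthickening _
  have hint : ∀ g : E → ℝ, LocallyIntegrableOn g U μ → Integrable (K.indicator g) μ := fun g hg =>
    (integrable_indicator_iff hKm).2 (hg.integrableOn_compact_subset hδU hKc)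
  have hint' : ∀ (g : E → ℝ) (s : ℝ), s ≠ 0 → LocallyIntegrableOn (fun x => |g x| ^ s) U μ →
      Integrable (fun x => |K.indicator g x| ^ s) μ := fun g s hs hg => by
    refine (hint _ hg).congr (Eventually.of_forall fun x => ?_)
    by_cases hx : x ∈ K <;> simp [hx, hs]
  have hzero : ∀ x, x ∉ tsupport w → w x = 0 ∧ ∀ v, fderiv ℝ w x v = 0 := fun x hx => by
    refine ⟨image_eq_zero_of_notMem_tsupport hx, fun v => ?_⟩
    rw [image_eq_zero_of_notMem_tsupport fun h => hx (tsupport_fderiv_subset ℝ h)]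
    simp
  -- The bounded ratio of the radii is what gives almost everywhere convergence at Lebesgue points.
  set φ : ℕ → ContDiffBump (0 : E) := fun n =>
    ⟨1 / (n + 1), 2 / (n + 1), by positivity, by gcongr; norm_num⟩ with hφdef
  have hφ : Tendsto (fun n => (φ n).rOut) atTop (𝓝 0) := by
    have := (tendsto_one_div_add_atTop_nhds_zero_nat (𝕜 := ℝ)).const_mul 2
    simpa [hφdef, mul_one_div, div_eq_mul_inv] using this
  have hφ' : ∀ n, (φ n).rOut ≤ 2 * (φ n).rIn := fun n => by
    simp [hφdef, div_eq_mul_inv]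
  obtain ⟨W₁, hW₁⟩ := hw.continuous.bounded_above_of_compact_support hwc
  obtain ⟨W₂, hW₂⟩ := (hw.continuous_fderiv one_ne_zero).bounded_above_of_compact_support
    (hwc.fderiv (𝕜 := ℝ))
  have hW₁0 : 0 ≤ W₁ := (norm_nonneg _).trans (hW₁ 0)
  have hW₂0 : 0 ≤ W₂ := (norm_nonneg _).trans (hW₂ 0)
  have hbi : ∀ i, ‖b i‖ ≤ ∑ j, ‖b j‖ := fun i =>
    Finset.single_le_sum (f := fun j => ‖b j‖) (fun j _ => norm_nonneg _) (Finset.mem_univ i)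
  have hrK := hint r hr
  have main := integral_chain_nonpos_of_mollify_nonpos (μ := μ) hφ hφ' hpq (hint r hr)
    (hint' r p hpq.ne_zero hrp) (fun i => hint _ (hD i)) (fun i => hint' _ _ hpq.ne_zero (hDp i))
    (fun i => hint _ (hB i)) (fun i => hint' _ _ hpq.symm.ne_zero (hBq i)) hf hL
    (w := w) (w' := fun i x => fderiv ℝ w x (b i)) hw.continuous
    (fun i => (hw.continuous_fderiv one_ne_zero).clm_apply continuous_const)
    (W := W₁ + W₂ * ∑ j, ‖b j‖)
    (fun x => (hW₁ x).trans (le_add_of_nonneg_right (by positivity)))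
    (fun i x => by
      refine ((fderiv ℝ w x).le_opNorm (b i)).trans ?_
      have := mul_le_mul (hW₂ x) (hbi i) (norm_nonneg _) hW₂0
      linarith) ?_
  · have heq : (fun x => ∑ i, K.indicator (B i) x * (f (K.indicator r x) * fderiv ℝ w x (b i) +
        w x * (deriv f (K.indicator r x) * K.indicator (D i) x))) =
        fun x => ∑ i, B i x * (f (r x) * fderiv ℝ w x (b i) +
          w x * (deriv f (r x) * D i x)) := by
      ext x
      refine Finset.sum_congr rfl fun i _ => ?_
      by_cases hx : x ∈ K
      · simp [hx]
      · simp [hzero x fun h => hx (hwK h)]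
    rw [heq] at main
    refine ⟨main.1.integrableOn, ?_⟩
    rw [setIntegral_eq_integral_of_forall_compl_eq_zero fun x hx => ?_]
    · exact main.2
    · refine Finset.sum_eq_zero fun i _ => ?_
      simp [hzero x fun h => hx (hwU h)]
  · filter_upwards [hφ.eventually (Iio_mem_nhds hδ)] with n hn
    have hR := contDiff_mollify (φ n) hrK.locallyIntegrable
    set R := mollify μ (φ n) (K.indicator r) with hRdef
    have hR0 : ∀ x, 0 ≤ R x := mollify_nonneg _ (by
      rw [ae_restrict_iff' hU.measurableSet] at hr0
      filter_upwards [hr0] with x hx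
      by_cases hxK : x ∈ K
      · simpa [hxK] using hx (hδU hxK)
      · simp [hxK])
    have hfR : ContDiff ℝ 1 fun x => f (R x) := hf.comp hR
    have hts : tsupport (fun x => w x * f (R x)) ⊆ tsupport w := tsupport_mul_subset_left
    have h := hsub (fun x => w x * f (R x)) (hw.mul hfR) hwc.mul_right (hts.trans hwU)
      fun x => mul_nonneg (hw0 x) (hf0 _ (hR0 x))
    rw [setIntegral_eq_integral_of_forall_compl_eq_zero fun x hx => ?_] at h
    · refine le_of_eq_of_le (integral_congr_ae (Eventually.of_forall fun x => ?_)) h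
      refine Finset.sum_congr rfl fun i _ => ?_
      have hd : fderiv ℝ (fun x => w x * f (R x)) x (b i) =
          w x * (deriv f (R x) * fderiv ℝ R x (b i)) + f (R x) * fderiv ℝ w x (b i) := by
        have hw1 := hw.differentiable one_ne_zero x
        have hR1 := hR.differentiable one_ne_zero x
        have hf1 := (hf.differentiable one_ne_zero (R x)).hasDerivAt
        have hfR1 : HasFDerivAt (fun y => f (R y)) (deriv f (R x) • fderiv ℝ R x) x :=
          hf1.comp_hasFDerivAt x hR1.hasFDerivAt
        rw [(hw1.hasFDerivAt.fun_mul hfR1).fderiv]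
        simp
      by_cases hx : x ∈ tsupport w
      · have hball : Metric.closedBall x (φ n).rOut ⊆ K :=
          (Metric.closedBall_subset_closedBall (le_of_lt hn)).trans
            (Metric.closedBall_subset_cthickening hx δ)
        have hdR : fderiv ℝ R x (b i) = mollify μ (φ n) (K.indicator (D i)) x := by
          refine fderiv_mollify_apply _ hrK.locallyIntegrable _ _ fun ψ hψ hψc hψs => ?_
          have := hweak i ψ hψ hψc (hψs.trans (hball.trans hδU))
          have hψK : ∀ y, y ∉ K → ψ y = 0 ∧ fderiv ℝ ψ y = 0 := fun y hy =>
            ⟨image_eq_zero_of_notMem_tsupport fun h => hy (hball (hψs h)),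
              image_eq_zero_of_notMem_tsupport fun h =>
                hy (hball (hψs (tsupport_fderiv_subset ℝ h)))⟩
          rw [setIntegral_eq_integral_of_forall_compl_eq_zero fun y hy => by
            simp [hψK y fun h => hy (hδU h)], setIntegral_eq_integral_of_forall_compl_eq_zero
              fun y hy => by simp [hψK y fun h => hy (hδU h)]] at this
          convert this using 2
          · ext y
            by_cases hy : y ∈ K
            · simp [hy]
            · simp [hψK y hy]
          · refine integral_congr_ae (Eventually.of_forall fun y => ?_)
            by_cases hy : y ∈ K
            · simp [hy]
            · simp [hψK y hy]
        rw [hd, hdR, indicator_of_mem (hwK hx)]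
        ring
      · rw [hd]
        simp [hzero x hx]
    · refine Finset.sum_eq_zero fun i _ => ?_
      have : fderiv ℝ (fun x => w x * f (R x)) x = 0 :=
        image_eq_zero_of_notMem_tsupport fun h =>
          hx (hwU (hts (tsupport_fderiv_subset ℝ h)))
      simp [this]

end Mollify

/-! ### The metric in coordinates -/

section Charts

variable {N : ℕ} {M : Type*} [TopologicalSpace M] [ChartedSpace (EuclideanSpace ℝ (Fin N)) M]
  {e : OpenPartialHomeomorph M (EuclideanSpace ℝ (Fin N))}

theorem mfderiv_symm_eq_sum_coordVec
    (y : EuclideanSpace ℝ (Fin N)) (a : EuclideanSpace ℝ (Fin N)) :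
    mfderiv (𝓡 N) (𝓡 N) e.symm y (a : TangentSpace (𝓡 N) y) = ∑ i, a i • coordVec e y i := by
  have h : a = ∑ i, a i • EuclideanSpace.single i (1 : ℝ) := by
    ext j
    simp [Finset.sum_apply, Pi.single_apply]
  set T : EuclideanSpace ℝ (Fin N) →L[ℝ] TangentSpace (𝓡 N) (e.symm y) :=
    mfderiv (𝓡 N) (𝓡 N) e.symm y with hT
  change T a = ∑ i, a i • T (EuclideanSpace.single i (1 : ℝ))
  conv_lhs => rw [h]
  simp only [map_sum, map_smul]

section

variable [RiemannianBundle (fun x : M => TangentSpace (𝓡 N) x)]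

theorem inner_riemannianGrad (u : M → ℝ) (x : M) (v : TangentSpace (𝓡 N) x) :
    inner ℝ v (riemannianGrad N u x) = mfderiv (𝓡 N) 𝓘(ℝ, ℝ) u x v := by
  have : FiniteDimensional ℝ (TangentSpace (𝓡 N) x) :=
    inferInstanceAs (FiniteDimensional ℝ (EuclideanSpace ℝ (Fin N)))
  have : CompleteSpace (TangentSpace (𝓡 N) x) := FiniteDimensional.complete ℝ _
  rw [real_inner_comm]
  exact InnerProductSpace.toDual_symm_apply

end

variable [IsManifold (𝓡 N) ∞ M]

theorem mdifferentiable_of_mem_atlas' (he : e ∈ atlas (EuclideanSpace ℝ (Fin N)) M) :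
    e.MDifferentiable (𝓡 N) (𝓡 N) := by
  have : IsManifold (𝓡 N) 1 M := IsManifold.of_le (n := ∞) (by exact_mod_cast le_top)
  exact mdifferentiable_of_mem_atlas he

theorem contMDiffOn_symm_of_mem_atlas (he : e ∈ atlas (EuclideanSpace ℝ (Fin N)) M) :
    ContMDiffOn (𝓡 N) (𝓡 N) ∞ e.symm e.target :=
  contMDiffOn_symm_of_mem_maximalAtlas (IsManifold.subset_maximalAtlas he)

theorem contMDiffOn_of_mem_atlas (he : e ∈ atlas (EuclideanSpace ℝ (Fin N)) M) :
    ContMDiffOn (𝓡 N) (𝓡 N) ∞ e e.source :=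
  contMDiffOn_of_mem_maximalAtlas (IsManifold.subset_maximalAtlas he)

theorem exists_eq_sum_coordVec (he : e ∈ atlas (EuclideanSpace ℝ (Fin N)) M)
    {y : EuclideanSpace ℝ (Fin N)} (hy : y ∈ e.target) (v : TangentSpace (𝓡 N) (e.symm y)) :
    ∃ a : Fin N → ℝ, v = ∑ i, a i • coordVec e y i := by
  obtain ⟨a, rfl⟩ := (mdifferentiable_of_mem_atlas' he).symm.mfderiv_surjective (x := y) hy v
  exact ⟨_, mfderiv_symm_eq_sum_coordVec y a⟩

theorem linearIndependent_coordVec (he : e ∈ atlas (EuclideanSpace ℝ (Fin N)) M)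
    {y : EuclideanSpace ℝ (Fin N)} (hy : y ∈ e.target) :
    LinearIndependent ℝ (coordVec e y) := by
  rw [Fintype.linearIndependent_iff]
  intro a ha i
  have h := (mdifferentiable_of_mem_atlas' he).symm.mfderiv_injective (x := y) hy
  have h0 : mfderiv (𝓡 N) (𝓡 N) e.symm y
      (WithLp.toLp 2 a : EuclideanSpace ℝ (Fin N)) = 0 := by
    rw [mfderiv_symm_eq_sum_coordVec]
    exact ha
  have h1 : (WithLp.toLp 2 a : EuclideanSpace ℝ (Fin N)) = 0 := h (h0.trans (map_zero _).symm)
  simpa using congrArg (fun z : EuclideanSpace ℝ (Fin N) => z i) h1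

theorem continuousOn_coordVec (he : e ∈ atlas (EuclideanSpace ℝ (Fin N)) M) (i : Fin N) :
    ContinuousOn (fun y => (⟨e.symm y, coordVec e y i⟩ : TangentBundle (𝓡 N) M)) e.target := by
  have h1 := (contMDiffOn_symm_of_mem_atlas he).continuousOn_tangentMapWithin
    -- The coordinate field is the image of a constant section under the tangent map of `e.symm`.
    (by exact_mod_cast le_top) e.open_target.uniqueMDiffOn
  have h2 : Continuous (fun y : EuclideanSpace ℝ (Fin N) =>
      (⟨y, (EuclideanSpace.single i (1 : ℝ) : EuclideanSpace ℝ (Fin N))⟩ :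
        TangentBundle (𝓡 N) (EuclideanSpace ℝ (Fin N)))) := by
    rw [← (tangentBundleModelSpaceHomeomorph (𝓡 N)).comp_continuous_iff]
    exact continuous_id.prodMk continuous_const
  refine (h1.comp h2.continuousOn (fun y hy => hy)).congr fun y hy => ?_
  simp only [Function.comp, tangentMapWithin, coordVec]
  rw [mfderivWithin_of_isOpen e.open_target hy]

variable [RiemannianBundle (fun x : M => TangentSpace (𝓡 N) x)]

theorem posDef_chartGram (he : e ∈ atlas (EuclideanSpace ℝ (Fin N)) M)
    {y : EuclideanSpace ℝ (Fin N)} (hy : y ∈ e.target) : (chartGram e y).PosDef :=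
  Matrix.posDef_gram_of_linearIndependent (linearIndependent_coordVec he hy)

theorem det_chartGram_pos (he : e ∈ atlas (EuclideanSpace ℝ (Fin N)) M)
    {y : EuclideanSpace ℝ (Fin N)} (hy : y ∈ e.target) : 0 < (chartGram e y).det :=
  (posDef_chartGram he hy).det_pos

/-- The `i`-th contravariant component, in the chart `e`, of a tangent vector. -/
noncomputable def coordCoeff (e : OpenPartialHomeomorph M (EuclideanSpace ℝ (Fin N)))
    (y : EuclideanSpace ℝ (Fin N)) (v : TangentSpace (𝓡 N) (e.symm y)) (i : Fin N) : ℝ :=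
  ∑ j, (chartGram e y)⁻¹ i j * inner ℝ v (coordVec e y j)

theorem sum_coordCoeff_smul_coordVec (he : e ∈ atlas (EuclideanSpace ℝ (Fin N)) M)
    {y : EuclideanSpace ℝ (Fin N)} (hy : y ∈ e.target) (v : TangentSpace (𝓡 N) (e.symm y)) :
    ∑ i, coordCoeff e y v i • coordVec e y i = v := by
  obtain ⟨a, rfl⟩ := exists_eq_sum_coordVec he hy v
  refine Finset.sum_congr rfl fun i _ => ?_
  congr 1
  have hG : ∀ j, inner ℝ (∑ i, a i • coordVec e y i) (coordVec e y j) =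
      (chartGram e y).mulVec a j := fun j => by
    rw [sum_inner, Matrix.mulVec, dotProduct]
    refine Finset.sum_congr rfl fun k _ => ?_
    rw [real_inner_smul_left, real_inner_comm, mul_comm]
    rfl
  have h := congrFun (Matrix.mulVec_mulVec a (chartGram e y)⁻¹ (chartGram e y)) i
  rw [Matrix.nonsing_inv_mul _ (det_chartGram_pos he hy).ne'.isUnit, Matrix.one_mulVec] at h
  simp only [coordCoeff, hG]
  exact h

theorem norm_sq_eq_sum_coordCoeff (he : e ∈ atlas (EuclideanSpace ℝ (Fin N)) M)
    {y : EuclideanSpace ℝ (Fin N)} (hy : y ∈ e.target) (v : TangentSpace (𝓡 N) (e.symm y)) :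
    ‖v‖ ^ 2 = ∑ i, coordCoeff e y v i * inner ℝ v (coordVec e y i) := by
  rw [← real_inner_self_eq_norm_sq]
  conv_lhs => rw [← sum_coordCoeff_smul_coordVec he hy v]
  rw [sum_inner]
  refine Finset.sum_congr rfl fun i _ => ?_
  rw [real_inner_smul_left, real_inner_comm, sum_coordCoeff_smul_coordVec he hy v]

theorem inner_riemannianGrad_coordVec (he : e ∈ atlas (EuclideanSpace ℝ (Fin N)) M)
    {y : EuclideanSpace ℝ (Fin N)} (hy : y ∈ e.target) {u : M → ℝ}
    (hu : MDifferentiableAt (𝓡 N) 𝓘(ℝ, ℝ) u (e.symm y)) (i : Fin N) :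
    inner ℝ (riemannianGrad N u (e.symm y)) (coordVec e y i) =
      fderiv ℝ (fun z => u (e.symm z)) y (EuclideanSpace.single i (1 : ℝ)) := by
  rw [real_inner_comm, inner_riemannianGrad]
  have h := mfderiv_comp y hu ((mdifferentiable_of_mem_atlas' he).mdifferentiableAt_symm hy)
  rw [mfderiv_eq_fderiv] at h
  change _ = fderiv ℝ (u ∘ e.symm) y _
  rw [h]
  rfl

theorem inner_riemannianGrad_eq_sum (he : e ∈ atlas (EuclideanSpace ℝ (Fin N)) M)
    {y : EuclideanSpace ℝ (Fin N)} (hy : y ∈ e.target) {u : M → ℝ}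
    (hu : MDifferentiableAt (𝓡 N) 𝓘(ℝ, ℝ) u (e.symm y)) (v : TangentSpace (𝓡 N) (e.symm y)) :
    inner ℝ v (riemannianGrad N u (e.symm y)) = ∑ i, coordCoeff e y v i *
      fderiv ℝ (fun z => u (e.symm z)) y (EuclideanSpace.single i (1 : ℝ)) := by
  conv_lhs => rw [← sum_coordCoeff_smul_coordVec he hy v]
  rw [sum_inner]
  refine Finset.sum_congr rfl fun i _ => ?_
  rw [real_inner_smul_left, real_inner_comm, inner_riemannianGrad_coordVec he hy hu]

variable [IsContMDiffRiemannianBundle (𝓡 N) ∞ (EuclideanSpace ℝ (Fin N))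
      (fun x : M => TangentSpace (𝓡 N) x)]

theorem continuousOn_chartGram (he : e ∈ atlas (EuclideanSpace ℝ (Fin N)) M) :
    ContinuousOn (chartGram e) e.target := by
  have : IsContinuousRiemannianBundle (EuclideanSpace ℝ (Fin N))
      (fun x : M => TangentSpace (𝓡 N) x) := by
    obtain ⟨g, hg, hg'⟩ := IsContMDiffRiemannianBundle.exists_contMDiff (IB := 𝓡 N) (n := ∞)
      (F := EuclideanSpace ℝ (Fin N)) (E := fun x : M => TangentSpace (𝓡 N) x)
    exact ⟨g, hg.continuous, hg'⟩
  refine continuousOn_pi.2 fun i => continuousOn_pi.2 fun j => ?_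
  exact (continuousOn_coordVec he i).inner_bundle (continuousOn_coordVec he j)

theorem continuousOn_chartGram_inv (he : e ∈ atlas (EuclideanSpace ℝ (Fin N)) M) (i j : Fin N) :
    ContinuousOn (fun y => (chartGram e y)⁻¹ i j) e.target := by
  have hG := continuousOn_chartGram he
  simp only [Matrix.inv_def, Matrix.smul_apply, Ring.inverse_eq_inv', smul_eq_mul]
  refine ContinuousOn.mul (ContinuousOn.inv₀ ?_ fun y hy => (det_chartGram_pos he hy).ne') ?_
  · exact (continuous_id.matrix_det).comp_continuousOn hG
  · exact ((continuous_id.matrix_adjugate).matrix_elem i j).comp_continuousOn hG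

theorem continuousOn_norm_coordVec (he : e ∈ atlas (EuclideanSpace ℝ (Fin N)) M) (i : Fin N) :
    ContinuousOn (fun y => ‖coordVec e y i‖) e.target := by
  have h : ∀ y, ‖coordVec e y i‖ = Real.sqrt (chartGram e y i i) := fun y => by
    rw [norm_eq_sqrt_real_inner]
    rfl
  simp only [h]
  exact Real.continuous_sqrt.comp_continuousOn
    ((continuous_id.matrix_elem i i).comp_continuousOn (continuousOn_chartGram he))

theorem continuousOn_sqrt_det_chartGram (he : e ∈ atlas (EuclideanSpace ℝ (Fin N)) M) :
    ContinuousOn (fun y => Real.sqrt (chartGram e y).det) e.target :=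
  Real.continuous_sqrt.comp_continuousOn
    ((continuous_id.matrix_det).comp_continuousOn (continuousOn_chartGram he))

theorem aemeasurable_chartDensity (he : e ∈ atlas (EuclideanSpace ℝ (Fin N)) M) :
    AEMeasurable (fun y => ENNReal.ofReal (Real.sqrt (chartGram e y).det))
      (volume.restrict e.target) :=
  ((continuousOn_sqrt_det_chartGram he).aemeasurable e.open_target.measurableSet).ennreal_ofReal

end Charts

/-! ### The Riemannian volume in a chart -/

theorem ContinuousOn.measurableSet_inter_preimage {α β : Type*} [TopologicalSpace α]
    [MeasurableSpace α] [OpensMeasurableSpace α] [TopologicalSpace β] [MeasurableSpace β]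
    [BorelSpace β] {f : α → β} {s : Set α} (hf : ContinuousOn f s) (hs : MeasurableSet s)
    {t : Set β} (ht : MeasurableSet t) : MeasurableSet (s ∩ f ⁻¹' t) := by
  have h := hs.subtype_image ((continuousOn_iff_continuous_domRestrict.1 hf).measurable ht)
  convert h using 1
  ext x
  simp [and_comm]

section

variable {N : ℕ} {M : Type*} [TopologicalSpace M] [MeasurableSpace M] [BorelSpace M]

theorem aemeasurable_symm_chartDensity
    (e : OpenPartialHomeomorph M (EuclideanSpace ℝ (Fin N))) (d : EuclideanSpace ℝ (Fin N) → ℝ≥0∞) :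
    AEMeasurable e.symm ((volume.restrict e.target).withDensity d) :=
  (e.continuousOn_symm.aemeasurable e.open_target.measurableSet).mono_ac
    (withDensity_absolutelyContinuous _ _)

theorem measurableSet_target_inter_preimage
    (e : OpenPartialHomeomorph M (EuclideanSpace ℝ (Fin N))) {A : Set M} (hA : MeasurableSet A) :
    MeasurableSet (e.target ∩ e.symm ⁻¹' A) :=
  e.continuousOn_symm.measurableSet_inter_preimage e.open_target.measurableSet hA

end

section Volume

variable {N : ℕ} {M : Type*} [TopologicalSpace M] [ChartedSpace (EuclideanSpace ℝ (Fin N)) M]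
  {e e' : OpenPartialHomeomorph M (EuclideanSpace ℝ (Fin N))}

variable [RiemannianBundle (fun x : M => TangentSpace (𝓡 N) x)]

section

variable [MeasurableSpace M]

theorem chartVolume_le_riemannianVolume (he : e ∈ atlas (EuclideanSpace ℝ (Fin N)) M) :
    chartVolume e ≤ riemannianVolume N M :=
  le_iSup₂ (f := fun e (_ : e ∈ atlas (EuclideanSpace ℝ (Fin N)) M) => chartVolume e) e he

variable [BorelSpace M]

theorem chartVolume_apply (e : OpenPartialHomeomorph M (EuclideanSpace ℝ (Fin N)))
    {A : Set M} (hA : MeasurableSet A) :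
    chartVolume e A = ∫⁻ y in e.target ∩ e.symm ⁻¹' A,
      ENNReal.ofReal (Real.sqrt (chartGram e y).det) := by
  rw [chartVolume, Measure.map_apply_of_aemeasurable (aemeasurable_symm_chartDensity e _) hA,
    withDensity_apply', Measure.restrict_restrict' e.open_target.measurableSet, inter_comm]

/-- The chart `e` pushes `chartVolume e` back to the weighted Lebesgue measure, so measurability
descends from coordinates. This lets `integrable_chartVolume_iff` hold for arbitrary `F`. -/
theorem aestronglyMeasurable_chartVolume_of_comp {F : M → ℝ}
    (hF : AEStronglyMeasurable (fun y => F (e.symm y)) ((volume.restrict e.target).withDensity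
      fun y => ENNReal.ofReal (Real.sqrt (chartGram e y).det))) :
    AEStronglyMeasurable F (chartVolume e) := by
  set ν := (volume.restrict e.target).withDensity
      fun y => ENNReal.ofReal (Real.sqrt (chartGram e y).det) with hν
  have hes : AEMeasurable e.symm ν := aemeasurable_symm_chartDensity e _
  have hsrc : ∀ᵐ x ∂(chartVolume e), x ∈ e.source := by
    refine (ae_map_iff hes e.open_source.measurableSet).2 ?_
    refine (withDensity_absolutelyContinuous _ _).ae_le ?_
    filter_upwards [ae_restrict_mem e.open_target.measurableSet] with y hy
    exact e.map_target hy
  have heq : (chartVolume e).restrict e.source = chartVolume e :=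
    Measure.restrict_eq_self_of_ae_mem hsrc
  have he : AEMeasurable e (chartVolume e) := by
    rw [← heq]
    exact e.continuousOn.aemeasurable e.open_source.measurableSet
  have hmap : Measure.map e (chartVolume e) = ν := by
    rw [chartVolume, AEMeasurable.map_map_of_aemeasurable he hes]
    conv_rhs => rw [← Measure.map_id (μ := ν)]
    refine Measure.map_congr ?_
    refine (withDensity_absolutelyContinuous _ _).ae_le ?_
    filter_upwards [ae_restrict_mem e.open_target.measurableSet] with y hy
    exact e.right_inv hy
  rw [← hmap] at hF
  refine (hF.comp_aemeasurable he).congr ?_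
  filter_upwards [hsrc] with x hx
  simp [e.left_inv hx]

theorem chartVolume_inter_source (e : OpenPartialHomeomorph M (EuclideanSpace ℝ (Fin N)))
    {A : Set M} (hA : MeasurableSet A) : chartVolume e (A ∩ e.source) = chartVolume e A := by
  rw [chartVolume_apply e hA, chartVolume_apply e (hA.inter e.open_source.measurableSet)]
  congr 2
  ext y
  simp only [mem_inter_iff, mem_preimage]
  exact ⟨fun h => ⟨h.1, h.2.1⟩, fun h => ⟨h.1, h.2, e.map_target h.1⟩⟩

end

variable [IsManifold (𝓡 N) ∞ M]

/-- With `J` the Jacobian of the transition map, the Gram matrices satisfy `G = Jᵀ G' J`; take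
determinants. -/
theorem sqrt_det_chartGram_transition (he : e ∈ atlas (EuclideanSpace ℝ (Fin N)) M)
    (he' : e' ∈ atlas (EuclideanSpace ℝ (Fin N)) M)
    {y : EuclideanSpace ℝ (Fin N)} (hy : y ∈ e.target) (hy' : e.symm y ∈ e'.source) :
    DifferentiableAt ℝ (fun z => e' (e.symm z)) y ∧
    Real.sqrt (chartGram e y).det = |(fderiv ℝ (fun z => e' (e.symm z)) y).det| *
      Real.sqrt (chartGram e' (e' (e.symm y))).det := by
  set τ := fun z => e' (e.symm z) with hτ
  have hd : MDifferentiableAt (𝓡 N) (𝓡 N) τ y :=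
    ((mdifferentiable_of_mem_atlas' he').mdifferentiableAt hy').comp y
      ((mdifferentiable_of_mem_atlas' he).mdifferentiableAt_symm hy)
  refine ⟨hd.differentiableAt, ?_⟩
  set J : EuclideanSpace ℝ (Fin N) →L[ℝ] EuclideanSpace ℝ (Fin N) := fderiv ℝ τ y with hJ
  -- All tangent spaces are copies of the model space. Making the base point an explicit argument
  -- allows rewriting along `e'.symm (τ y) = e.symm y`.
  let F : M → EuclideanSpace ℝ (Fin N) → EuclideanSpace ℝ (Fin N) → ℝ := fun x v w =>
    @inner ℝ (TangentSpace (𝓡 N) x) _ v w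
  let A : EuclideanSpace ℝ (Fin N) →L[ℝ] EuclideanSpace ℝ (Fin N) :=
    mfderiv (𝓡 N) (𝓡 N) e.symm y
  let A' : EuclideanSpace ℝ (Fin N) →L[ℝ] EuclideanSpace ℝ (Fin N) :=
    mfderiv (𝓡 N) (𝓡 N) e'.symm (τ y)
  have hx : e'.symm (τ y) = e.symm y := e'.left_inv hy'
  have hA : A = A'.comp J := by
    have h1 : e.symm =ᶠ[𝓝 y] e'.symm ∘ τ := by
      filter_upwards [e.isOpen_inter_preimage_symm e'.open_source |>.mem_nhds ⟨hy, hy'⟩] with z hz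
      exact (e'.left_inv hz.2).symm
    have h2 := mfderiv_comp (I := 𝓡 N) (I' := 𝓡 N) (I'' := 𝓡 N) y
      ((mdifferentiable_of_mem_atlas' he').mdifferentiableAt_symm (e'.map_source hy')) hd
    have h3 := h1.mfderiv_eq (I := 𝓡 N) (I' := 𝓡 N)
    have h4 : mfderiv (𝓡 N) (𝓡 N) τ y = J := mfderiv_eq_fderiv
    rw [h4] at h2
    exact h3.trans h2
  let G' : Matrix (Fin N) (Fin N) ℝ := Matrix.of fun k l =>
    F (e.symm y) (A' (EuclideanSpace.single k 1)) (A' (EuclideanSpace.single l 1))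
  have hG' : chartGram e' (τ y) = G' := by
    ext k l
    change F (e'.symm (τ y)) _ _ = _
    rw [hx]
    rfl
  let b := (EuclideanSpace.basisFun (Fin N) ℝ).toBasis
  set P := LinearMap.toMatrix b b (J : EuclideanSpace ℝ (Fin N) →ₗ[ℝ] EuclideanSpace ℝ (Fin N))
    with hP
  have hJe : ∀ i, J (EuclideanSpace.single i 1) = ∑ k, P k i • EuclideanSpace.single k (1 : ℝ) := by
    intro i
    ext j
    simp [P, b, LinearMap.toMatrix_apply, Pi.single_apply]
  have hF₁ : ∀ x (c : Fin N → ℝ) (v : Fin N → EuclideanSpace ℝ (Fin N)) w,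
      F x (∑ k, c k • v k) w = ∑ k, c k * F x (v k) w := fun x c v w => by
    have := sum_inner (𝕜 := ℝ) (E := TangentSpace (𝓡 N) x) Finset.univ (fun k => c k • v k) w
    refine this.trans (Finset.sum_congr rfl fun k _ => ?_)
    exact real_inner_smul_left (F := TangentSpace (𝓡 N) x) _ _ _
  have hF₂ : ∀ x (c : Fin N → ℝ) (v : Fin N → EuclideanSpace ℝ (Fin N)) w,
      F x w (∑ k, c k • v k) = ∑ k, c k * F x w (v k) := fun x c v w => by
    have hs : ∀ a b, F x a b = F x b a := fun a b =>
      real_inner_comm (F := TangentSpace (𝓡 N) x) _ _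
    simp only [hs w, hF₁]
  have hG : chartGram e y = P.transpose * G' * P := by
    ext i j
    change F (e.symm y) (A (EuclideanSpace.single i 1)) (A (EuclideanSpace.single j 1)) = _
    rw [hA, ContinuousLinearMap.comp_apply, ContinuousLinearMap.comp_apply, hJe, hJe]
    simp only [map_sum, map_smul, hF₁, hF₂, Matrix.mul_apply, Matrix.transpose_apply,
      Finset.sum_mul, Finset.mul_sum]
    rw [Finset.sum_comm]
    refine Finset.sum_congr rfl fun k _ => Finset.sum_congr rfl fun l _ => ?_
    simp only [G', Matrix.of_apply]
    ring
  have hdet : J.det = P.det := (LinearMap.det_toMatrix b _).symm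
  rw [hG', hG, Matrix.det_mul, Matrix.det_mul, Matrix.det_transpose, hdet,
    show P.det * G'.det * P.det = P.det ^ 2 * G'.det by ring, Real.sqrt_mul (sq_nonneg _),
    Real.sqrt_sq_eq_abs]

variable [MeasurableSpace M] [BorelSpace M]

theorem chartVolume_eq_of_subset (he : e ∈ atlas (EuclideanSpace ℝ (Fin N)) M)
    (he' : e' ∈ atlas (EuclideanSpace ℝ (Fin N)) M) {A : Set M} (hA : MeasurableSet A)
    (hAs : A ⊆ e.source) (hAs' : A ⊆ e'.source) : chartVolume e A = chartVolume e' A := by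
  set τ := fun z => e' (e.symm z) with hτ
  have himg : e'.target ∩ e'.symm ⁻¹' A = τ '' (e.target ∩ e.symm ⁻¹' A) := by
    ext z
    constructor
    · rintro ⟨hz, hz'⟩
      have hz' : e'.symm z ∈ A := hz'
      refine ⟨e (e'.symm z), ⟨e.map_source (hAs hz'), ?_⟩, ?_⟩
      · rwa [mem_preimage, e.left_inv (hAs hz')]
      · simp only [hτ]
        rw [e.left_inv (hAs hz'), e'.right_inv hz]
    · rintro ⟨y, ⟨hy, hy'⟩, rfl⟩
      refine ⟨e'.map_source (hAs' hy'), ?_⟩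
      rw [mem_preimage, e'.left_inv (hAs' hy')]
      exact hy'
  have hinj : InjOn τ (e.target ∩ e.symm ⁻¹' A) := fun y hy z hz h =>
    e.symm.injOn hy.1 hz.1 (e'.injOn (hAs' hy.2) (hAs' hz.2) h)
  rw [chartVolume_apply e hA, chartVolume_apply e' hA, himg,
    lintegral_image_eq_lintegral_abs_det_fderiv_mul volume
      (measurableSet_target_inter_preimage e hA)
      (fun y hy => ((sqrt_det_chartGram_transition he he' hy.1
        (hAs' hy.2)).1.hasFDerivAt.hasFDerivWithinAt)) hinj]
  refine setLIntegral_congr_fun (measurableSet_target_inter_preimage e hA) fun y hy => ?_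
  rw [(sqrt_det_chartGram_transition he he' hy.1 (hAs' hy.2)).2,
    ENNReal.ofReal_mul (abs_nonneg _)]

/-- By the change of variables formula, any other chart volume agrees with `chartVolume e` on the
overlap. So each is at most `chartVolume e` plus the part of the total volume outside `e.source`,
and the supremum obeys the same bound. -/
theorem restrict_riemannianVolume_source (he : e ∈ atlas (EuclideanSpace ℝ (Fin N)) M) :
    (riemannianVolume N M).restrict e.source = chartVolume e := by
  have hm := e.open_source.measurableSet
  refine le_antisymm ?_ ?_
  · have hle : riemannianVolume N M ≤
        chartVolume e + (riemannianVolume N M).restrict e.sourceᶜ := by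
      refine iSup₂_le fun e' he' => ?_
      rw [← Measure.restrict_add_restrict_compl (μ := chartVolume e') hm]
      refine add_le_add (Measure.le_iff.2 fun A hA => ?_)
        (Measure.restrict_mono_measure (chartVolume_le_riemannianVolume he') _)
      rw [Measure.restrict_apply hA, ← chartVolume_inter_source e' (hA.inter hm),
        chartVolume_eq_of_subset he' he ((hA.inter hm).inter e'.open_source.measurableSet)
          inter_subset_right (inter_subset_left.trans inter_subset_right)]
      exact measure_mono (inter_subset_left.trans inter_subset_left)
    refine (Measure.restrict_mono_measure hle e.source).trans ?_
    rw [Measure.restrict_add, Measure.restrict_restrict hm, inter_compl_self,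
      Measure.restrict_empty, add_zero]
    exact Measure.restrict_le_self
  · refine Measure.le_iff.2 fun A hA => ?_
    rw [Measure.restrict_apply hA, ← chartVolume_inter_source e hA]
    exact chartVolume_le_riemannianVolume he _

end Volume

/-! ### Transport of integrals between the manifold and coordinates -/

section Transport

variable {N : ℕ} {M : Type*} [TopologicalSpace M] [ChartedSpace (EuclideanSpace ℝ (Fin N)) M]
  {e : OpenPartialHomeomorph M (EuclideanSpace ℝ (Fin N))}
  [IsManifold (𝓡 N) ∞ M]
  [RiemannianBundle (fun x : M => TangentSpace (𝓡 N) x)]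
  [IsContMDiffRiemannianBundle (𝓡 N) ∞ (EuclideanSpace ℝ (Fin N))
      (fun x : M => TangentSpace (𝓡 N) x)]
  [MeasurableSpace M] [BorelSpace M]

theorem integrable_chartVolume_iff (he : e ∈ atlas (EuclideanSpace ℝ (Fin N)) M) (F : M → ℝ) :
    Integrable F (chartVolume e) ↔
      IntegrableOn (fun y => Real.sqrt (chartGram e y).det * F (e.symm y)) e.target := by
  have h1 := integrable_withDensity_iff_integrable_smul₀' (aemeasurable_chartDensity he)
    (Eventually.of_forall fun _ => ENNReal.ofReal_lt_top) (g := fun y => F (e.symm y))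
  simp only [ENNReal.toReal_ofReal (Real.sqrt_nonneg _), smul_eq_mul] at h1
  rw [IntegrableOn, ← h1]
  refine ⟨fun h => h.comp_aemeasurable (aemeasurable_symm_chartDensity e _), fun h => ?_⟩
  exact (integrable_map_measure (aestronglyMeasurable_chartVolume_of_comp h.aestronglyMeasurable)
    (aemeasurable_symm_chartDensity e _)).2 h

theorem integral_chartVolume (he : e ∈ atlas (EuclideanSpace ℝ (Fin N)) M) (F : M → ℝ) :
    ∫ x, F x ∂(chartVolume e) =
      ∫ y in e.target, Real.sqrt (chartGram e y).det * F (e.symm y) := by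
  by_cases h : Integrable F (chartVolume e)
  · rw [chartVolume, integral_map (aemeasurable_symm_chartDensity e _) h.aestronglyMeasurable,
      integral_withDensity_eq_integral_toReal_smul₀ (aemeasurable_chartDensity he)
        (Eventually.of_forall fun _ => ENNReal.ofReal_lt_top)]
    simp only [ENNReal.toReal_ofReal (Real.sqrt_nonneg _), smul_eq_mul]
  · rw [integral_undef h, integral_undef fun h' => h ((integrable_chartVolume_iff he F).2 h')]

theorem integrableOn_inter_source_iff (he : e ∈ atlas (EuclideanSpace ℝ (Fin N)) M) {A : Set M}
    (hA : MeasurableSet A) (F : M → ℝ) :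
    IntegrableOn F (A ∩ e.source) (riemannianVolume N M) ↔
      IntegrableOn (fun y => Real.sqrt (chartGram e y).det * F (e.symm y))
        (e.target ∩ e.symm ⁻¹' A) := by
  have hU := measurableSet_target_inter_preimage e hA
  rw [IntegrableOn, ← Measure.restrict_restrict hA, restrict_riemannianVolume_source he,
    ← IntegrableOn, ← integrable_indicator_iff hA, integrable_chartVolume_iff he, ← integrable_indicator_iff hU,
    ← integrable_indicator_iff e.open_target.measurableSet]
  refine iff_of_eq (congrArg (Integrable · volume) (funext fun y => ?_))
  by_cases h1 : y ∈ e.target <;> by_cases h2 : e.symm y ∈ A <;> simp [h1, h2]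

theorem setIntegral_inter_source (he : e ∈ atlas (EuclideanSpace ℝ (Fin N)) M) {A : Set M}
    (hA : MeasurableSet A) (F : M → ℝ) :
    ∫ x in A ∩ e.source, F x ∂(riemannianVolume N M) =
      ∫ y in e.target ∩ e.symm ⁻¹' A, Real.sqrt (chartGram e y).det * F (e.symm y) := by
  have hU := measurableSet_target_inter_preimage e hA
  rw [← Measure.restrict_restrict hA, restrict_riemannianVolume_source he,
    ← integral_indicator hA, integral_chartVolume he, ← integral_indicator hU,
    ← integral_indicator e.open_target.measurableSet]
  refine congrArg (integral volume) (funext fun y => ?_)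
  by_cases h1 : y ∈ e.target <;> by_cases h2 : e.symm y ∈ A <;> simp [h1, h2]

/-- The density is positive on the chart range, so null sets for the volume are Lebesgue null in
coordinates. -/
theorem ae_comp_symm (he : e ∈ atlas (EuclideanSpace ℝ (Fin N)) M) {A : Set M}
    (hA : MeasurableSet A) {P : M → Prop}
    (h : ∀ᵐ x ∂((riemannianVolume N M).restrict A), P x) :
    ∀ᵐ y ∂(volume.restrict (e.target ∩ e.symm ⁻¹' A)), P (e.symm y) := by
  rw [ae_restrict_iff' hA] at h
  have h1 := (Measure.absolutelyContinuous_of_le (chartVolume_le_riemannianVolume he)).ae_le h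
  have h2 := ae_of_ae_map (aemeasurable_symm_chartDensity e _) h1
  rw [ae_withDensity_iff' (aemeasurable_chartDensity he),
    ae_restrict_iff' e.open_target.measurableSet] at h2
  rw [ae_restrict_iff' (measurableSet_target_inter_preimage e hA)]
  filter_upwards [h2] with y hy hyU
  refine hy hyU.1 ?_ hyU.2
  simpa using det_chartGram_pos he hyU.1

theorem locallyIntegrableOn_comp_symm [T2Space M] (he : e ∈ atlas (EuclideanSpace ℝ (Fin N)) M)
    {Ω : Set M} (hΩ : IsOpen Ω) {F : M → ℝ}
    (hF : LocallyIntegrableOn F Ω (riemannianVolume N M)) :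
    LocallyIntegrableOn (fun y => F (e.symm y)) (e.target ∩ e.symm ⁻¹' Ω) := by
  rw [locallyIntegrableOn_iff (e.isOpen_inter_preimage_symm hΩ).isLocallyClosed]
  intro K hK hKc
  have hc : IsCompact (e.symm '' K) :=
    hKc.image_of_continuousOn (e.continuousOn_symm.mono fun y hy => (hK hy).1)
  have hsub : e.symm '' K ⊆ Ω := by
    rintro _ ⟨y, hy, rfl⟩
    exact (hK hy).2
  have h1 := (hF.integrableOn_compact_subset hsub hc).mono_set
    (inter_subset_left (t := e.source))
  rw [integrableOn_inter_source_iff he hc.measurableSet] at h1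
  have h2 := h1.mono_set (s := K) fun y hy => ⟨(hK hy).1, mem_image_of_mem _ hy⟩
  have hcont : ContinuousOn (fun y => (Real.sqrt (chartGram e y).det)⁻¹) K :=
    ((continuousOn_sqrt_det_chartGram he).mono fun y hy => (hK hy).1).inv₀ fun y hy =>
      (Real.sqrt_pos.2 (det_chartGram_pos he (hK hy).1)).ne'
  refine (h2.continuousOn_mul hcont hKc).congr_fun (fun y hy => ?_) hKc.measurableSet
  have := (Real.sqrt_pos.2 (det_chartGram_pos he (hK hy).1)).ne'
  field_simp

end Transport

/-! ### The tested inequality in one chart -/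

/-- Extension by zero is `C¹` because the transported support is compact, hence closed in a
Hausdorff space. It is used with `Φ = e` for test functions and with `Φ = e.symm` for the weight
`w`. -/
theorem contMDiff_indicator_comp {N : ℕ} {X Y : Type*} [TopologicalSpace X] [T2Space X]
    [ChartedSpace (EuclideanSpace ℝ (Fin N)) X] [TopologicalSpace Y]
    [ChartedSpace (EuclideanSpace ℝ (Fin N)) Y] {Φ : OpenPartialHomeomorph X Y}
    (hΦ : ContMDiffOn (𝓡 N) (𝓡 N) 1 Φ Φ.source) {f : Y → ℝ}
    (hf : ContMDiff (𝓡 N) 𝓘(ℝ, ℝ) 1 f) (hc : HasCompactSupport f) (hs : tsupport f ⊆ Φ.target) :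
    ContMDiff (𝓡 N) 𝓘(ℝ, ℝ) 1 (Φ.source.indicator fun x => f (Φ x)) ∧
      HasCompactSupport (Φ.source.indicator fun x => f (Φ x)) ∧
      tsupport (Φ.source.indicator fun x => f (Φ x)) ⊆ Φ.symm '' tsupport f := by
  have hK : IsCompact (Φ.symm '' tsupport f) :=
    hc.isCompact.image_of_continuousOn (Φ.continuousOn_symm.mono hs)
  have hsupp : Function.support (Φ.source.indicator fun x => f (Φ x)) ⊆
      Φ.symm '' tsupport f := by
    intro x hx
    have hxs : x ∈ Φ.source := by
      by_contra h
      exact hx (indicator_of_notMem h _)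
    refine ⟨Φ x, subset_closure ?_, Φ.left_inv hxs⟩
    rwa [Function.mem_support, indicator_of_mem hxs] at hx
  have hts := closure_minimal hsupp hK.isClosed
  refine ⟨fun x => ?_, HasCompactSupport.of_support_subset_isCompact hK hsupp, hts⟩
  by_cases hx : x ∈ Φ.source
  · have h1 : ContMDiffAt (𝓡 N) 𝓘(ℝ, ℝ) 1 (fun x => f (Φ x)) x :=
      (hf (Φ x)).comp x (hΦ.contMDiffAt (Φ.open_source.mem_nhds hx))
    refine h1.congr_of_eventuallyEq ?_
    filter_upwards [Φ.open_source.mem_nhds hx] with z hz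
    exact indicator_of_mem hz _
  · have hx' : x ∉ Φ.symm '' tsupport f := by
      rintro ⟨y, hy, rfl⟩
      exact hx (Φ.map_target (hs hy))
    refine (contMDiffAt_const (c := (0 : ℝ))).congr_of_eventuallyEq ?_
    filter_upwards [hK.isClosed.isOpen_compl.mem_nhds hx'] with z hz
    by_contra h
    exact hz (hsupp h)

theorem locallyIntegrableOn_of_abs_le_mul {E : Type*} [TopologicalSpace E] [T2Space E]
    [LocallyCompactSpace E] [SecondCountableTopology E] [MeasurableSpace E] [BorelSpace E]
    {μ : Measure E} {U : Set E} (hU : IsOpen U) {F G κ : E → ℝ}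
    (hF : AEStronglyMeasurable F (μ.restrict U)) (hG : LocallyIntegrableOn G U μ)
    (hκ : ContinuousOn κ U) (hle : ∀ y ∈ U, |F y| ≤ κ y * G y) : LocallyIntegrableOn F U μ := by
  rw [locallyIntegrableOn_iff hU.isLocallyClosed]
  intro K hK hKc
  refine Integrable.mono' ((hG.integrableOn_compact_subset hK hKc).continuousOn_mul
    (hκ.mono hK) hKc) (hF.mono_measure (Measure.restrict_mono_set _ hK)) ?_
  filter_upwards [ae_restrict_mem hKc.measurableSet] with y hy
  exact hle y (hK hy)

section ChartInequality

variable {N : ℕ} {M : Type*} [TopologicalSpace M] [ChartedSpace (EuclideanSpace ℝ (Fin N)) M]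
  {e : OpenPartialHomeomorph M (EuclideanSpace ℝ (Fin N))}
  [RiemannianBundle (fun x : M => TangentSpace (𝓡 N) x)]

theorem riemannianGrad_eq_zero_of_notMem_tsupport {u : M → ℝ} {x : M} (hx : x ∉ tsupport u) :
    riemannianGrad N u x = 0 := by
  rw [← inner_self_eq_zero (𝕜 := ℝ), inner_riemannianGrad]
  have h : u =ᶠ[𝓝 x] fun _ => (0 : ℝ) := notMem_tsupport_iff_eventuallyEq.1 hx
  rw [h.mfderiv_eq (I := 𝓡 N) (I' := 𝓘(ℝ, ℝ)), mfderiv_const]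
  rfl

theorem abs_coordCoeff_le (y : EuclideanSpace ℝ (Fin N)) (v : TangentSpace (𝓡 N) (e.symm y))
    (i : Fin N) :
    |coordCoeff e y v i| ≤ (∑ j, |(chartGram e y)⁻¹ i j| * ‖coordVec e y j‖) * ‖v‖ := by
  rw [coordCoeff, Finset.sum_mul]
  refine (Finset.abs_sum_le_sum_abs _ _).trans (Finset.sum_le_sum fun j _ => ?_)
  rw [abs_mul, mul_assoc, mul_comm ‖coordVec e y j‖]
  exact mul_le_mul_of_nonneg_left (abs_real_inner_le_norm _ _) (abs_nonneg _)

variable [IsManifold (𝓡 N) ∞ M]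
  [IsContMDiffRiemannianBundle (𝓡 N) ∞ (EuclideanSpace ℝ (Fin N))
      (fun x : M => TangentSpace (𝓡 N) x)]
  [MeasurableSpace M] [BorelSpace M] [T2Space M]

/-- In coordinates the `p`-Laplacian is the divergence of `B i = √(det g) |V|^(p-2) Vⁱ`. Since `|B
i|` is at most a continuous factor times `|V|^(p-1)`, it lies locally in the conjugate space of
`L^p`, and `integral_chain_nonpos` applies. -/
theorem integral_chain_nonpos_of_tsupport_subset_source
    (he : e ∈ atlas (EuclideanSpace ℝ (Fin N)) M) {p : ℝ} (hp : 1 < p)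
    {Ω : Set M} (hΩ : IsOpen Ω) {ρ : M → ℝ} {V : ∀ x : M, TangentSpace (𝓡 N) x}
    (hρ0 : ∀ᵐ x ∂((riemannianVolume N M).restrict Ω), 0 ≤ ρ x)
    (hρW : MemSobolevLoc p Ω ρ V) (hsub : IsPSubharmonic p Ω ρ V)
    {f : ℝ → ℝ} (hf : ContDiff ℝ 1 f) (hf0 : ∀ t, 0 ≤ t → 0 ≤ f t) {L : ℝ}
    (hL : ∀ t, |deriv f t| ≤ L)
    {w : M → ℝ} (hw : ContMDiff (𝓡 N) 𝓘(ℝ, ℝ) 1 w) (hwc : HasCompactSupport w)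
    (hwΩ : tsupport w ⊆ Ω) (hwe : tsupport w ⊆ e.source) (hw0 : ∀ x, 0 ≤ w x) :
    IntegrableOn (fun x => ‖V x‖ ^ (p - 2) * (f (ρ x) * inner ℝ (V x) (riemannianGrad N w x) +
        w x * (deriv f (ρ x) * ‖V x‖ ^ 2))) Ω (riemannianVolume N M) ∧
      ∫ x in Ω, ‖V x‖ ^ (p - 2) * (f (ρ x) * inner ℝ (V x) (riemannianGrad N w x) +
        w x * (deriv f (ρ x) * ‖V x‖ ^ 2)) ∂(riemannianVolume N M) ≤ 0 := by
  have hq := Real.HolderConjugate.conjExponent hp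
  set q := Real.conjExponent p
  set U := e.target ∩ e.symm ⁻¹' Ω with hUdef
  have hU : IsOpen U := e.isOpen_inter_preimage_symm hΩ
  have hUt : U ⊆ e.target := inter_subset_left
  have hUm : MeasurableSet U := hU.measurableSet
  obtain ⟨hr, hD⟩ := hρW.isWeakGrad e he
  set D : Fin N → EuclideanSpace ℝ (Fin N) → ℝ :=
    fun i y => inner ℝ (V (e.symm y)) (coordVec e y i) with hDdef
  set κ : Fin N → EuclideanSpace ℝ (Fin N) → ℝ :=
    fun i y => ∑ j, |(chartGram e y)⁻¹ i j| * ‖coordVec e y j‖ with hκdef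
  have hκ0 : ∀ i y, 0 ≤ κ i y := fun i y => by positivity
  have hκc : ∀ i, ContinuousOn (κ i) U := fun i => continuousOn_finsetSum _ fun j _ =>
    ((continuousOn_chartGram_inv he i j).mono hUt).abs.mul
      ((continuousOn_norm_coordVec he j).mono hUt)
  have hsc : ContinuousOn (fun y => Real.sqrt (chartGram e y).det) U :=
    (continuousOn_sqrt_det_chartGram he).mono hUt
  have hDm : ∀ i, AEStronglyMeasurable (D i) (volume.restrict U) :=
    fun i => (hD i).1.aestronglyMeasurable
  set c : Fin N → EuclideanSpace ℝ (Fin N) → ℝ :=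
    fun i y => coordCoeff e y (V (e.symm y)) i with hcdef
  have hcm : ∀ i, AEStronglyMeasurable (c i) (volume.restrict U) := fun i =>
    Finset.aestronglyMeasurable_fun_sum _ fun j _ =>
      (((continuousOn_chartGram_inv he i j).mono hUt).aestronglyMeasurable hUm).mul (hDm j)
  set n : EuclideanSpace ℝ (Fin N) → ℝ := fun y => ‖V (e.symm y)‖ with hndef
  have hn0 : ∀ y, 0 ≤ n y := fun y => norm_nonneg _
  have hn2 : ∀ y ∈ U, n y ^ 2 = ∑ i, c i y * D i y := fun y hy =>
    norm_sq_eq_sum_coordCoeff he (hUt hy) _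
  -- Measurability of `|V|` comes from its covariant components, which are locally integrable by the
  -- definition of weak gradient.
  have hnm : AEMeasurable n (volume.restrict U) := by
    have h1 : AEStronglyMeasurable (fun y => Real.sqrt (∑ i, c i y * D i y))
        (volume.restrict U) := Real.continuous_sqrt.comp_aestronglyMeasurable
      (Finset.aestronglyMeasurable_fun_sum _ fun i _ => (hcm i).mul (hDm i))
    refine h1.aemeasurable.congr ?_
    filter_upwards [ae_restrict_mem hUm] with y hy
    rw [← hn2 y hy, Real.sqrt_sq (hn0 y)]
  have hnp : LocallyIntegrableOn (fun y => n y ^ p) U :=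
    locallyIntegrableOn_comp_symm he hΩ hρW.locallyIntegrableOn_grad
  have hnp1 : LocallyIntegrableOn (fun y => n y ^ (p - 1)) U :=
    locallyIntegrableOn_comp_symm he hΩ hsub.locallyIntegrableOn_grad
  have hrp : LocallyIntegrableOn (fun y => |ρ (e.symm y)| ^ p) U :=
    locallyIntegrableOn_comp_symm he hΩ hρW.locallyIntegrableOn
  have hDp : ∀ i, LocallyIntegrableOn (fun y => |D i y| ^ p) U := fun i => by
    refine locallyIntegrableOn_of_abs_le_mul hU (κ := fun y => ‖coordVec e y i‖ ^ p)
      ((hDm i).aemeasurable.abs.pow_const p).aestronglyMeasurable hnp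
      (((continuousOn_norm_coordVec he i).mono hUt).rpow_const
        fun y _ => Or.inr hq.nonneg) fun y _ => ?_
    rw [abs_of_nonneg (Real.rpow_nonneg (abs_nonneg _) _),
      ← Real.mul_rpow (norm_nonneg _) (hn0 y)]
    refine Real.rpow_le_rpow (abs_nonneg _) ?_ hq.nonneg
    rw [mul_comm]
    exact abs_real_inner_le_norm _ _
  set B : Fin N → EuclideanSpace ℝ (Fin N) → ℝ :=
    fun i y => Real.sqrt (chartGram e y).det * (n y ^ (p - 2) * c i y) with hBdef
  have hBm : ∀ i, AEStronglyMeasurable (B i) (volume.restrict U) := fun i =>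
    (hsc.aestronglyMeasurable hUm).mul ((hnm.pow_const _).aestronglyMeasurable.mul (hcm i))
  -- At `n y = 0` both sides vanish because `p > 1`, even when `p - 2` is negative.
  have hnpow : ∀ y, n y ^ (p - 2) * n y = n y ^ (p - 1) := fun y => by
    rcases (hn0 y).eq_or_lt with h | h
    · rw [← h, mul_zero, Real.zero_rpow (by linarith)]
    · rw [← Real.rpow_add_one h.ne']
      ring_nf
  have hBle : ∀ i y, |B i y| ≤ (Real.sqrt (chartGram e y).det * κ i y) * n y ^ (p - 1) :=
    fun i y => by
      rw [abs_mul, abs_mul, abs_of_nonneg (Real.sqrt_nonneg _),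
        abs_of_nonneg (Real.rpow_nonneg (hn0 y) _), mul_assoc, ← hnpow y]
      refine mul_le_mul_of_nonneg_left ?_ (Real.sqrt_nonneg _)
      calc n y ^ (p - 2) * |c i y| ≤ n y ^ (p - 2) * (κ i y * n y) :=
            mul_le_mul_of_nonneg_left (abs_coordCoeff_le _ _ _) (Real.rpow_nonneg (hn0 y) _)
        _ = _ := by ring
  have hB : ∀ i, LocallyIntegrableOn (B i) U := fun i =>
    locallyIntegrableOn_of_abs_le_mul hU (hBm i) hnp1 (hsc.mul (hκc i)) fun y _ => hBle i y
  have hBq : ∀ i, LocallyIntegrableOn (fun y => |B i y| ^ q) U := fun i => by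
    refine locallyIntegrableOn_of_abs_le_mul hU
      (κ := fun y => (Real.sqrt (chartGram e y).det * κ i y) ^ q)
      ((hBm i).aemeasurable.abs.pow_const q).aestronglyMeasurable hnp
      ((hsc.mul (hκc i)).rpow_const fun y _ => Or.inr hq.symm.nonneg) fun y _ => ?_
    have h0 : 0 ≤ Real.sqrt (chartGram e y).det * κ i y :=
      mul_nonneg (Real.sqrt_nonneg _) (hκ0 i y)
    rw [abs_of_nonneg (Real.rpow_nonneg (abs_nonneg _) _), ← hq.sub_one_mul_conj,
      Real.rpow_mul (hn0 y), ← Real.mul_rpow h0 (Real.rpow_nonneg (hn0 y) _)]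
    exact Real.rpow_le_rpow (abs_nonneg _) (hBle i y) hq.symm.nonneg
  have hgrad : ∀ (φ : M → ℝ) (ψ : EuclideanSpace ℝ (Fin N) → ℝ),
      ContMDiff (𝓡 N) 𝓘(ℝ, ℝ) 1 φ → (∀ y ∈ e.target, φ (e.symm y) = ψ y) → ∀ y ∈ U,
      inner ℝ (V (e.symm y)) (riemannianGrad N φ (e.symm y)) =
        ∑ i, c i y * fderiv ℝ ψ y (EuclideanSpace.single i (1 : ℝ)) := by
    intro φ ψ hφ hφψ y hy
    rw [inner_riemannianGrad_eq_sum he (hUt hy) (hφ.mdifferentiable one_ne_zero _)]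
    have h : (fun z => φ (e.symm z)) =ᶠ[𝓝 y] ψ := by
      filter_upwards [e.open_target.mem_nhds (hUt hy)] with z hz using hφψ z hz
    rw [h.fderiv_eq]
  have htest : ∀ φ : EuclideanSpace ℝ (Fin N) → ℝ, ContDiff ℝ 1 φ → HasCompactSupport φ →
      tsupport φ ⊆ U → (∀ x, 0 ≤ φ x) →
      ∫ y in U, ∑ i, B i y * fderiv ℝ φ y (EuclideanSpace.single i (1 : ℝ)) ≤ 0 := by
    intro φ hφ hφc hφU hφ0
    obtain ⟨h1, h2, h3⟩ := contMDiff_indicator_comp (Φ := e)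
      ((contMDiffOn_of_mem_atlas he).of_le (by exact_mod_cast le_top)) hφ.contMDiff hφc
      (hφU.trans hUt)
    set ψ := e.source.indicator fun x => φ (e x) with hψdef
    have h4 : tsupport ψ ⊆ Ω ∩ e.source := by
      refine h3.trans ?_
      rintro _ ⟨y, hy, rfl⟩
      exact ⟨(hφU hy).2, e.map_target (hφU hy).1⟩
    have h5 := hsub.integral_nonpos ψ h1 h2 (h4.trans inter_subset_left)
      fun x => indicator_nonneg (fun x _ => hφ0 _) x
    have h6 : ∀ x ∈ Ω \ (Ω ∩ e.source),
        ‖V x‖ ^ (p - 2) * inner ℝ (V x) (riemannianGrad N ψ x) = 0 := fun x hx => by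
      rw [riemannianGrad_eq_zero_of_notMem_tsupport fun h => hx.2 (h4 h), inner_zero_right,
        mul_zero]
    rw [setIntegral_eq_of_subset_of_forall_sdiff_eq_zero hΩ.measurableSet
      (inter_subset_left (t := e.source)) h6,
      setIntegral_inter_source he hΩ.measurableSet] at h5
    refine le_of_eq_of_le (setIntegral_congr_fun hUm fun y hy => ?_) h5
    rw [hgrad ψ φ h1 (fun z hz => ?_) y hy, Finset.mul_sum, Finset.mul_sum]
    · refine Finset.sum_congr rfl fun i _ => ?_
      simp only [hBdef, hndef]
      ring
    · rw [hψdef, indicator_of_mem (e.map_target hz), e.right_inv hz]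
  obtain ⟨hw1, hw2, hw3⟩ := contMDiff_indicator_comp (Φ := e.symm)
    ((contMDiffOn_symm_of_mem_atlas he).of_le (by exact_mod_cast le_top)) hw hwc hwe
  set w' := e.symm.source.indicator fun y => w (e.symm y) with hw'def
  have hw'e : ∀ y ∈ e.target, w (e.symm y) = w' y := fun y hy => by
    rw [hw'def, indicator_of_mem (s := e.symm.source) hy]
  have hw'U : tsupport w' ⊆ U := by
    refine hw3.trans ?_
    rintro _ ⟨x, hx, rfl⟩
    refine ⟨e.map_source (hwe hx), ?_⟩
    change e.symm (e x) ∈ Ω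
    rw [e.left_inv (hwe hx)]
    exact hwΩ hx
  have main := integral_chain_nonpos hU hq (ae_comp_symm he hΩ.measurableSet hρ0) hr hrp
    (fun i => (hD i).1) hDp hB hBq (fun i => (hD i).2) htest hf hf0 hL hw1.contDiff hw2 hw'U
    fun y => indicator_nonneg (fun x _ => hw0 _) y
  have hzero : ∀ x ∈ Ω \ (Ω ∩ e.source), ‖V x‖ ^ (p - 2) *
      (f (ρ x) * inner ℝ (V x) (riemannianGrad N w x) +
        w x * (deriv f (ρ x) * ‖V x‖ ^ 2)) = 0 := fun x hx => by
    have hx' : x ∉ tsupport w := fun h => hx.2 ⟨hx.1, hwe h⟩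
    rw [riemannianGrad_eq_zero_of_notMem_tsupport hx', image_eq_zero_of_notMem_tsupport hx']
    simp
  have hcongr : EqOn (fun y => Real.sqrt (chartGram e y).det * (‖V (e.symm y)‖ ^ (p - 2) *
      (f (ρ (e.symm y)) * inner ℝ (V (e.symm y)) (riemannianGrad N w (e.symm y)) +
        w (e.symm y) * (deriv f (ρ (e.symm y)) * ‖V (e.symm y)‖ ^ 2))))
      (fun y => ∑ i, B i y * (f (ρ (e.symm y)) *
        fderiv ℝ w' y (EuclideanSpace.single i (1 : ℝ)) +
        w' y * (deriv f (ρ (e.symm y)) * D i y))) U := by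
    intro y hy
    have h1 := hn2 y hy
    simp only [hndef] at h1
    simp only
    rw [hgrad w w' hw hw'e y hy, hw'e y (hUt hy), h1, Finset.mul_sum, Finset.mul_sum,
      Finset.mul_sum, ← Finset.sum_add_distrib, Finset.mul_sum, Finset.mul_sum]
    refine Finset.sum_congr rfl fun i _ => ?_
    simp only [hBdef, hndef]
    ring
  constructor
  · refine IntegrableOn.of_forall_sdiff_eq_zero ?_ hΩ.measurableSet hzero
    rw [integrableOn_inter_source_iff he hΩ.measurableSet]
    exact main.1.congr_fun hcongr.symm hUm
  · rw [setIntegral_eq_of_subset_of_forall_sdiff_eq_zero hΩ.measurableSet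
      (inter_subset_left (t := e.source)) hzero, setIntegral_inter_source he hΩ.measurableSet,
      setIntegral_congr_fun hUm hcongr]
    exact main.2

end ChartInequality

/-! ### The tested inequality on the manifold -/

section Global

variable {N : ℕ} {M : Type*} [TopologicalSpace M] [ChartedSpace (EuclideanSpace ℝ (Fin N)) M]
  [RiemannianBundle (fun x : M => TangentSpace (𝓡 N) x)]

theorem inner_riemannianGrad_sum {ι : Type*} {t : Finset ι} {w : ι → M → ℝ} {x : M}
    (hw : ∀ i ∈ t, MDifferentiableAt (𝓡 N) 𝓘(ℝ, ℝ) (w i) x) (v : TangentSpace (𝓡 N) x) :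
    inner ℝ v (riemannianGrad N (fun y => ∑ i ∈ t, w i y) x) =
      ∑ i ∈ t, inner ℝ v (riemannianGrad N (w i) x) := by
  -- The differentials take values in tangent spaces of `ℝ` at different points; viewed as
  -- functionals into `ℝ` they can be summed.
  obtain ⟨g, hg⟩ : ∃ g : ι → TangentSpace (𝓡 N) x →L[ℝ] ℝ,
      ∀ i, mfderiv (𝓡 N) 𝓘(ℝ, ℝ) (w i) x = g i := ⟨_, fun _ => rfl⟩
  have hw' : ∀ i ∈ t, HasMFDerivAt (𝓡 N) 𝓘(ℝ, ℝ) (w i) x (g i) := fun i hi =>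
    hg i ▸ (hw i hi).hasMFDerivAt
  have h : HasMFDerivAt (𝓡 N) 𝓘(ℝ, ℝ) (fun y => ∑ i ∈ t, w i y) x (∑ i ∈ t, g i) := by
    clear hw
    classical
    induction t using Finset.induction_on with
    | empty => exact hasMFDerivAt_const (0 : ℝ) x
    | insert i s hi ih =>
      have h1 := (hw' i (Finset.mem_insert_self i s)).add
        (ih fun j hj => hw' j (Finset.mem_insert_of_mem hj))
      have h2 : (fun y => ∑ j ∈ insert i s, w j y) = w i + fun y => ∑ j ∈ s, w j y := by
        ext y
        exact Finset.sum_insert hi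
      have h3 : ∑ j ∈ insert i s, g j = g i + ∑ j ∈ s, g j := Finset.sum_insert hi
      rw [h2]
      exact h1.congr_mfderiv h3.symm
  simp only [inner_riemannianGrad, hg]
  rw [h.mfderiv]
  exact sum_apply _ _ _

theorem abs_inner_riemannianGrad_abs_rpow_le {p : ℝ} (hp : 1 < p) {u : M → ℝ} {x : M}
    (hu : MDifferentiableAt (𝓡 N) 𝓘(ℝ, ℝ) u x) (v : TangentSpace (𝓡 N) x) :
    |inner ℝ v (riemannianGrad N (fun y => |u y| ^ p) x)| ≤
      p * |u x| ^ (p - 1) * (‖v‖ * ‖riemannianGrad N u x‖) := by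
  have hd := hasDerivAt_abs_rpow (u x) hp
  have h := mfderiv_comp (I := 𝓡 N) (I' := 𝓘(ℝ, ℝ)) (I'' := 𝓘(ℝ, ℝ)) x
    hd.differentiableAt.mdifferentiableAt hu
  have h1 : inner ℝ v (riemannianGrad N (fun y => |u y| ^ p) x) =
      (p * |u x| ^ (p - 2) * u x) * inner ℝ v (riemannianGrad N u x) := by
    rw [inner_riemannianGrad, inner_riemannianGrad]
    change mfderiv (𝓡 N) 𝓘(ℝ, ℝ) ((fun t : ℝ => |t| ^ p) ∘ u) x v = _
    rw [h, mfderiv_eq_fderiv, hd.hasFDerivAt.fderiv]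
    exact mul_comm (_ : ℝ) _
  have hpow : |u x| ^ (p - 2) * |u x| = |u x| ^ (p - 1) := by
    rcases (abs_nonneg (u x)).eq_or_lt with h0 | h0
    · rw [← h0, mul_zero, Real.zero_rpow (by linarith)]
    · rw [← Real.rpow_add_one h0.ne']
      ring_nf
  rw [h1, abs_mul, abs_mul, abs_mul, abs_of_nonneg (by linarith : 0 ≤ p),
    abs_of_nonneg (Real.rpow_nonneg (abs_nonneg _) _), mul_assoc p, hpow]
  exact mul_le_mul_of_nonneg_left (abs_real_inner_le_norm _ _)
    (mul_nonneg (by linarith) (Real.rpow_nonneg (abs_nonneg _) _))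

variable [IsManifold (𝓡 N) ∞ M]
  [IsContMDiffRiemannianBundle (𝓡 N) ∞ (EuclideanSpace ℝ (Fin N))
      (fun x : M => TangentSpace (𝓡 N) x)]

theorem continuous_norm_riemannianGrad {u : M → ℝ} (hu : ContMDiff (𝓡 N) 𝓘(ℝ, ℝ) 1 u) :
    Continuous fun x => ‖riemannianGrad N u x‖ := by
  rw [continuous_iff_continuousAt]
  intro x
  set e := chartAt (EuclideanSpace ℝ (Fin N)) x with hedef
  have he : e ∈ atlas (EuclideanSpace ℝ (Fin N)) M := chart_mem_atlas _ x
  set d : Fin N → EuclideanSpace ℝ (Fin N) → ℝ :=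
    fun i y => fderiv ℝ (fun z => u (e.symm z)) y (EuclideanSpace.single i (1 : ℝ)) with hd
  have hus : ContDiffOn ℝ 1 (fun z => u (e.symm z)) e.target :=
    (hu.comp_contMDiffOn ((contMDiffOn_symm_of_mem_atlas he).of_le
      (by exact_mod_cast le_top))).contDiffOn
  have hdc : ∀ i, ContinuousOn (d i) e.target := fun i =>
    (hus.continuousOn_fderiv_of_isOpen e.open_target le_rfl).clm_apply continuousOn_const
  have hdi : ∀ i, ∀ y ∈ e.target,
      inner ℝ (riemannianGrad N u (e.symm y)) (coordVec e y i) = d i y := fun i y hy =>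
    inner_riemannianGrad_coordVec he hy (hu.mdifferentiable one_ne_zero _) i
  have hc : ContinuousOn (fun y => ‖riemannianGrad N u (e.symm y)‖) e.target := by
    have h1 : ContinuousOn (fun y => Real.sqrt (∑ i, (∑ j, (chartGram e y)⁻¹ i j * d j y) * d i y))
        e.target :=
      Real.continuous_sqrt.comp_continuousOn (continuousOn_finsetSum _ fun i _ =>
        (continuousOn_finsetSum _ fun j _ =>
          (continuousOn_chartGram_inv he i j).mul (hdc j)).mul (hdc i))
    refine h1.congr fun y hy => ?_
    rw [← Real.sqrt_sq (norm_nonneg (riemannianGrad N u (e.symm y))),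
      norm_sq_eq_sum_coordCoeff he hy]
    simp only [coordCoeff]
    congr 1
    refine Finset.sum_congr rfl fun i _ => ?_
    rw [hdi i y hy]
    congr 1
    refine Finset.sum_congr rfl fun j _ => ?_
    rw [hdi j y hy]
  have hcs : ContinuousOn (fun x => ‖riemannianGrad N u x‖) e.source := by
    refine (hc.comp e.continuousOn e.mapsTo).congr fun z hz => ?_
    simp only [Function.comp]
    rw [e.left_inv hz]
  exact hcs.continuousAt (e.open_source.mem_nhds (mem_chart_source _ x))

variable [MeasurableSpace M] [BorelSpace M] [T2Space M] [SigmaCompactSpace M]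

/-- The integrand is linear in `w`, so `w` may be split by a smooth partition of unity into
nonnegative pieces, each supported in one chart. Only finitely many meet the compact support of `w`.
-/
theorem integral_chain_nonpos_manifold {p : ℝ} (hp : 1 < p)
    {Ω : Set M} (hΩ : IsOpen Ω) {ρ : M → ℝ} {V : ∀ x : M, TangentSpace (𝓡 N) x}
    (hρ0 : ∀ᵐ x ∂((riemannianVolume N M).restrict Ω), 0 ≤ ρ x)
    (hρW : MemSobolevLoc p Ω ρ V) (hsub : IsPSubharmonic p Ω ρ V)
    {f : ℝ → ℝ} (hf : ContDiff ℝ 1 f) (hf0 : ∀ t, 0 ≤ t → 0 ≤ f t) {L : ℝ}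
    (hL : ∀ t, |deriv f t| ≤ L)
    {w : M → ℝ} (hw : ContMDiff (𝓡 N) 𝓘(ℝ, ℝ) 1 w) (hwc : HasCompactSupport w)
    (hwΩ : tsupport w ⊆ Ω) (hw0 : ∀ x, 0 ≤ w x) :
    IntegrableOn (fun x => ‖V x‖ ^ (p - 2) * (f (ρ x) * inner ℝ (V x) (riemannianGrad N w x) +
        w x * (deriv f (ρ x) * ‖V x‖ ^ 2))) Ω (riemannianVolume N M) ∧
      ∫ x in Ω, ‖V x‖ ^ (p - 2) * (f (ρ x) * inner ℝ (V x) (riemannianGrad N w x) +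
        w x * (deriv f (ρ x) * ‖V x‖ ^ 2)) ∂(riemannianVolume N M) ≤ 0 := by
  obtain ⟨η, hη⟩ := SmoothPartitionOfUnity.exists_isSubordinate_chartAt_source (𝓡 N) M
  have hfin := η.locallyFinite.finite_nonempty_inter_compact hwc.isCompact
  set J := hfin.toFinset with hJ
  set θ : M → M → ℝ := fun i x => η i x * w x with hθdef
  have hθ : ∀ i, ContMDiff (𝓡 N) 𝓘(ℝ, ℝ) 1 (θ i) := fun i =>
    ((η i).contMDiff.of_le (by exact_mod_cast le_top)).mul hw
  have hsum : w = fun x => ∑ i ∈ J, θ i x := by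
    ext x
    simp only [hθdef, ← Finset.sum_mul]
    by_cases hx : x ∈ tsupport w
    · rw [η.sum_finsupport' x (mem_univ x), one_mul]
      intro i hi
      rw [hJ, Set.Finite.mem_toFinset]
      exact ⟨x, (η.mem_finsupport _).1 hi, hx⟩
    · rw [image_eq_zero_of_notMem_tsupport hx, mul_zero]
  have key := fun i => integral_chain_nonpos_of_tsupport_subset_source
    (chart_mem_atlas (EuclideanSpace ℝ (Fin N)) i) hp hΩ hρ0 hρW hsub hf hf0 hL (hθ i)
    hwc.mul_left ((tsupport_mul_subset_right (f := η i)).trans hwΩ)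
    ((tsupport_mul_subset_left (g := w)).trans (hη i))
    fun x => mul_nonneg (η.nonneg i x) (hw0 x)
  have heq : (fun x => ‖V x‖ ^ (p - 2) * (f (ρ x) * inner ℝ (V x) (riemannianGrad N w x) +
        w x * (deriv f (ρ x) * ‖V x‖ ^ 2))) = fun x => ∑ i ∈ J, ‖V x‖ ^ (p - 2) *
        (f (ρ x) * inner ℝ (V x) (riemannianGrad N (θ i) x) +
        θ i x * (deriv f (ρ x) * ‖V x‖ ^ 2)) := by
    ext x
    have h1 : inner ℝ (V x) (riemannianGrad N w x) =
        ∑ i ∈ J, inner ℝ (V x) (riemannianGrad N (θ i) x) := by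
      conv_lhs => rw [hsum]
      exact inner_riemannianGrad_sum (fun i _ => (hθ i).mdifferentiable one_ne_zero x) _
    rw [h1, congrFun hsum x, ← Finset.mul_sum, Finset.sum_add_distrib, Finset.mul_sum,
      Finset.sum_mul]
  rw [heq]
  refine ⟨integrable_finsetSum _ fun i _ => (key i).1, ?_⟩
  rw [integral_finsetSum _ fun i _ => (key i).1]
  exact Finset.sum_nonpos fun i _ => (key i).2

end Global

/-! ### Approximation of powers -/

theorem exists_continuous_bounded_tendsto_rpow (q : ℝ) : ∃ h : ℕ → ℝ → ℝ,
    (∀ n, Continuous (h n)) ∧ (∀ n, ∃ L, ∀ t, |h n t| ≤ L) ∧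
    (∀ n t, 0 ≤ t → 0 ≤ h n t ∧ h n t ≤ t ^ q) ∧
    ∀ t, 0 ≤ t → Tendsto (fun n => h n t) atTop (𝓝 (t ^ q)) := by
  -- For `q ≠ 0` the convention `0 ^ q = 0` agrees with truncations vanishing at `0`. As `0 ^ 0 =
  -- 1`, the case `q = 0` is separate.
  by_cases hq : q = 0
  · subst hq
    exact ⟨fun _ _ => 1, fun _ => continuous_const, fun _ => ⟨1, fun _ => by simp⟩,
      fun _ _ _ => by simp, fun _ _ => by simp⟩
  -- A cutoff equal to `1` on `[2/(n+1), n]` and to `0` outside `(1/(n+1), n+1)`.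
  set χ : ℕ → ℝ → ℝ := fun n t => max 0 (min 1 (min ((n + 1) * t - 1) (n + 1 - t))) with hχ
  have hχ0 : ∀ n t, 0 ≤ χ n t := fun n t => le_max_left _ _
  have hχ1 : ∀ n t, χ n t ≤ 1 := fun n t => max_le zero_le_one (min_le_left _ _)
  have hχc : ∀ n, Continuous (χ n) := fun n => by fun_prop
  have hχl : ∀ (n : ℕ) (t : ℝ), (n + 1) * t ≤ 1 → χ n t = 0 := fun n t ht =>
    max_eq_left ((min_le_right _ _).trans ((min_le_left _ _).trans (by linarith)))
  have hχr : ∀ (n : ℕ) (t : ℝ), n + 1 ≤ t → χ n t = 0 := fun n t ht =>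
    max_eq_left ((min_le_right _ _).trans ((min_le_right _ _).trans (by linarith)))
  have hn : ∀ n : ℕ, (0 : ℝ) < n + 1 := fun n => by positivity
  -- The maximum keeps the base away from the singularity at `0` and changes nothing where `χ n` is
  -- nonzero.
  set h : ℕ → ℝ → ℝ := fun n t => (max t (1 / (n + 1))) ^ q * χ n t with hh
  have heq : ∀ n t, 0 ≤ t → h n t = t ^ q * χ n t := fun n t ht => by
    rcases le_total ((n + 1) * t) 1 with h1 | h1
    · simp [hh, hχl n t h1]
    · have : 1 / ((n : ℝ) + 1) ≤ t := by
        rw [div_le_iff₀ (hn n)]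
        linarith
      simp only [hh, max_eq_left this]
  have hc : ∀ n, Continuous (h n) := fun n =>
    ((continuous_id.max continuous_const).rpow_const fun t =>
      Or.inl (lt_max_of_lt_right (by have := hn n; positivity)).ne').mul (hχc n)
  refine ⟨h, hc, fun n => ?_, fun n t ht => ?_, fun t ht => ?_⟩
  · refine (hc n).bounded_above_of_compact_support
      (HasCompactSupport.of_support_subset_isCompact (isCompact_Icc (a := 0) (b := (n : ℝ) + 1)) ?_)
    intro t ht
    by_contra hcon
    refine ht ?_
    have : χ n t = 0 := by
      rcases lt_or_ge t 0 with h1 | h1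
      · exact hχl n t (by nlinarith [hn n])
      · exact hχr n t (not_lt.1 fun h2 => hcon ⟨h1, h2.le⟩)
    simp [hh, this]
  · rw [heq n t ht]
    have := Real.rpow_nonneg ht q
    exact ⟨mul_nonneg this (hχ0 n t), mul_le_of_le_one_right this (hχ1 n t)⟩
  · rcases ht.eq_or_lt with h0 | h0
    · rw [← h0]
      refine tendsto_const_nhds.congr fun n => ?_
      rw [heq n 0 le_rfl, hχl n 0 (by simp), mul_zero, Real.zero_rpow hq]
    · refine tendsto_const_nhds.congr' ?_
      have h1 : Tendsto (fun n : ℕ => (n : ℝ) + 1) atTop atTop :=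
        tendsto_atTop_add_const_right _ _ tendsto_natCast_atTop_atTop
      filter_upwards [h1.eventually_ge_atTop (2 / t), h1.eventually_ge_atTop (1 + t)] with n h2 h3
      rw [div_le_iff₀ h0] at h2
      have : χ n t = 1 := by
        simp only [hχ]
        rw [min_eq_left (le_min (by linarith) (by linarith)), max_eq_right zero_le_one]
      rw [heq n t ht, this, mul_one]

/-- Integrate the bounded approximations of `(q+1) s^q` from `0`. The condition `q > -1` makes `s^q`
integrable at `0`, so it dominates. -/
theorem exists_contDiff_tendsto_rpow {q : ℝ} (hq : -1 < q) : ∃ f : ℕ → ℝ → ℝ,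
    (∀ n, ContDiff ℝ 1 (f n)) ∧ (∀ n, ∃ L, ∀ t, |deriv (f n) t| ≤ L) ∧
    (∀ n t, 0 ≤ t → 0 ≤ f n t ∧ f n t ≤ t ^ (q + 1)) ∧
    (∀ n t, 0 ≤ t → 0 ≤ deriv (f n) t ∧ deriv (f n) t ≤ (q + 1) * t ^ q) ∧
    (∀ t, 0 ≤ t → Tendsto (fun n => f n t) atTop (𝓝 (t ^ (q + 1)))) ∧
    ∀ t, 0 ≤ t → Tendsto (fun n => deriv (f n) t) atTop (𝓝 ((q + 1) * t ^ q)) := by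
  obtain ⟨h, hc, hb, hle, ht⟩ := exists_continuous_bounded_tendsto_rpow q
  have hq0 : 0 < q + 1 := by linarith
  set f : ℕ → ℝ → ℝ := fun n t => (q + 1) * ∫ s in (0 : ℝ)..t, h n s with hf
  have hd : ∀ n t, HasDerivAt (f n) ((q + 1) * h n t) t := fun n t =>
    ((hc n).integral_hasStrictDerivAt 0 t).hasDerivAt.const_mul _
  have hd' : ∀ n, deriv (f n) = fun t => (q + 1) * h n t := fun n => funext fun t => (hd n t).deriv
  have hint : ∀ t : ℝ, IntervalIntegrable (fun s => s ^ q) volume 0 t := fun t =>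
    intervalIntegral.intervalIntegrable_rpow' hq
  have hval : ∀ t : ℝ, (q + 1) * ∫ s in (0 : ℝ)..t, s ^ q = t ^ (q + 1) := fun t => by
    rw [integral_rpow (Or.inl hq), Real.zero_rpow hq0.ne', sub_zero]
    field_simp
  refine ⟨f, fun n => ?_, fun n => ?_, fun n t ht0 => ⟨?_, ?_⟩, fun n t ht0 => ⟨?_, ?_⟩,
    fun t ht0 => ?_, fun t ht0 => ?_⟩
  · rw [contDiff_one_iff_deriv, hd']
    exact ⟨fun t => (hd n t).differentiableAt, continuous_const.mul (hc n)⟩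
  · obtain ⟨L, hL⟩ := hb n
    refine ⟨(q + 1) * L, fun t => ?_⟩
    rw [hd', abs_mul, abs_of_pos hq0]
    exact mul_le_mul_of_nonneg_left (hL t) hq0.le
  · exact mul_nonneg hq0.le
      (intervalIntegral.integral_nonneg ht0 fun s hs => (hle n s hs.1).1)
  · rw [← hval t]
    exact mul_le_mul_of_nonneg_left (intervalIntegral.integral_mono_on ht0
      ((hc n).intervalIntegrable _ _) (hint t) fun s hs => (hle n s hs.1).2) hq0.le
  · rw [hd']
    exact mul_nonneg hq0.le (hle n t ht0).1
  · rw [hd']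
    exact mul_le_mul_of_nonneg_left (hle n t ht0).2 hq0.le
  · rw [← hval t]
    refine (intervalIntegral.tendsto_integral_filter_of_dominated_convergence (fun s => s ^ q)
      (Eventually.of_forall fun n => (hc n).aestronglyMeasurable)
      (Eventually.of_forall fun n => Eventually.of_forall fun s hs => ?_) (hint t)
      (Eventually.of_forall fun s hs => ?_)).const_mul _
    · rw [uIoc_of_le ht0] at hs
      rw [Real.norm_of_nonneg (hle n s hs.1.le).1]
      exact (hle n s hs.1.le).2
    · rw [uIoc_of_le ht0] at hs
      exact ht s hs.1.le
  · simp only [hd']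
    exact (ht t ht0).const_mul _

/-! ### The Hardy inequality -/

/-- For `a > 0` this is Young's inequality for `n v` and `a g / c`, multiplied by `a ^ q * c`. -/
theorem hardy_young {p q a n v g c : ℝ} (hp : 1 < p) (hq : -1 < q) (ha : 0 ≤ a) (hn : 0 ≤ n)
    (hv : 0 ≤ v) (hg : 0 ≤ g) (hc : 0 < c) :
    a ^ (q + 1) * (n ^ (p - 1) * (p * v ^ (p - 1) * g)) ≤
      (p - 1) * c * (a ^ q * n ^ p * v ^ p) + c ^ (1 - p) * (a ^ (p + q) * g ^ p) := by
  rcases ha.eq_or_lt with h0 | h0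
  · rw [← h0, Real.zero_rpow (by linarith), zero_mul]
    have hp1 : 0 ≤ p - 1 := by linarith
    positivity
  have h1 := rpow_sub_one_mul_le hp (mul_nonneg hn hv) (div_nonneg (mul_nonneg ha hg) hc.le)
  rw [Real.mul_rpow hn hv, Real.mul_rpow hn hv, Real.div_rpow (mul_nonneg ha hg) hc.le,
    Real.mul_rpow ha hg] at h1
  have h2 := mul_le_mul_of_nonneg_left h1 (mul_nonneg (Real.rpow_nonneg ha q) hc.le)
  have e1 : a ^ (q + 1) = a ^ q * a := Real.rpow_add_one h0.ne' q
  have e2 : a ^ (p + q) = a ^ q * a ^ p := by rw [Real.rpow_add h0, mul_comm]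
  have e3 : c ^ (1 - p) = c / c ^ p := by rw [Real.rpow_sub hc, Real.rpow_one]
  rw [e1, e2, e3]
  calc a ^ q * a * (n ^ (p - 1) * (p * v ^ (p - 1) * g))
      = a ^ q * c * (p * (n ^ (p - 1) * v ^ (p - 1)) * (a * g / c)) := by field_simp
    _ ≤ _ := h2
    _ = _ := by ring

theorem MeasureTheory.LocallyIntegrableOn.integrableOn_mul_of_continuous {X : Type*} [TopologicalSpace X]
    [T2Space X] [SecondCountableTopology X] [MeasurableSpace X] [BorelSpace X] {μ : Measure X}
    {Ω K : Set X} (hΩ : MeasurableSet Ω) {F G : X → ℝ} (hF : LocallyIntegrableOn F Ω μ)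
    (hG : Continuous G) (hK : IsCompact K) (hKΩ : K ⊆ Ω) (hGK : ∀ x ∉ K, G x = 0) :
    IntegrableOn (fun x => F x * G x) Ω μ :=
  ((hF.integrableOn_compact_subset hKΩ hK).mul_continuousOn hG.continuousOn
    hK).of_forall_sdiff_eq_zero hΩ fun x hx => by rw [hGK x hx.2, mul_zero]

theorem mainTheorem4 {N : ℕ} {M : Type*} [EMetricSpace M] [SecondCountableTopology M]
    [ChartedSpace (EuclideanSpace ℝ (Fin N)) M] [IsManifold (𝓡 N) ∞ M]
    [RiemannianBundle (fun x : M => TangentSpace (𝓡 N) x)]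
    [IsContMDiffRiemannianBundle (𝓡 N) ∞ (EuclideanSpace ℝ (Fin N))
      (fun x : M => TangentSpace (𝓡 N) x)]
    [IsRiemannianManifold (𝓡 N) M] [CompleteSpace M]
    [MeasurableSpace M] [BorelSpace M]
    (p q : ℝ) (hp : 1 < p) (hq : -1 < q)
    (Ω : Set M) (hΩ : IsOpen Ω)
    (ρ : M → ℝ) (V : ∀ x : M, TangentSpace (𝓡 N) x)
    (hρ : LocallyIntegrable ρ (riemannianVolume N M))
    (hρ0 : ∀ᵐ x ∂((riemannianVolume N M).restrict Ω), 0 ≤ ρ x)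
    (hρW : MemSobolevLoc p Ω ρ V)
    (hρ1 : LocallyIntegrableOn (fun x => ρ x ^ q * ‖V x‖ ^ p) Ω (riemannianVolume N M))
    (hρ2 : LocallyIntegrableOn (fun x => ρ x ^ (p + q)) Ω (riemannianVolume N M))
    (hsub : IsPSubharmonic p Ω ρ V)
    (u : M → ℝ) (hu : ContMDiff (𝓡 N) 𝓘(ℝ, ℝ) ∞ u) (hu_comp : HasCompactSupport u)
    (hu_supp : tsupport u ⊆ Ω) :
    IntegrableOn (fun x => ρ x ^ q * ‖V x‖ ^ p * |u x| ^ p) Ω (riemannianVolume N M) ∧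
    IntegrableOn (fun x => ρ x ^ (p + q) * ‖riemannianGrad N u x‖ ^ p) Ω
      (riemannianVolume N M) ∧
    ((q + 1) / p) ^ p *
        ∫ x in Ω, ρ x ^ q * ‖V x‖ ^ p * |u x| ^ p ∂(riemannianVolume N M) ≤
      ∫ x in Ω, ρ x ^ (p + q) * ‖riemannianGrad N u x‖ ^ p ∂(riemannianVolume N M) := by
  have hlc : LocallyCompactSpace M := ChartedSpace.locallyCompactSpace (EuclideanSpace ℝ (Fin N)) M
  set μ := riemannianVolume N M with hμ
  have hΩm : MeasurableSet Ω := hΩ.measurableSet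
  have hp0 : 0 < p := by linarith
  have hq1 : 0 < q + 1 := by linarith
  have hu1 : ContMDiff (𝓡 N) 𝓘(ℝ, ℝ) 1 u := hu.of_le (by exact_mod_cast le_top)
  set X : M → ℝ := fun x => ρ x ^ q * ‖V x‖ ^ p * |u x| ^ p with hX
  set Y : M → ℝ := fun x => ρ x ^ (p + q) * ‖riemannianGrad N u x‖ ^ p with hY
  have hXi : IntegrableOn X Ω μ := hρ1.integrableOn_mul_of_continuous hΩm
    (hu.continuous.abs.rpow_const fun _ => Or.inr hp0.le) hu_comp.isCompact hu_supp fun x hx => by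
      rw [image_eq_zero_of_notMem_tsupport hx, abs_zero, Real.zero_rpow hp0.ne']
  have hYi : IntegrableOn Y Ω μ := hρ2.integrableOn_mul_of_continuous hΩm
    ((continuous_norm_riemannianGrad hu1).rpow_const fun _ => Or.inr hp0.le) hu_comp.isCompact
    hu_supp fun x hx => by
      rw [riemannianGrad_eq_zero_of_notMem_tsupport hx, norm_zero, Real.zero_rpow hp0.ne']
  refine ⟨hXi, hYi, ?_⟩
  -- With this weight Young leaves `pc - (p-1)c = c` in front of the left integral.
  set c := (q + 1) / p with hc
  have hc0 : 0 < c := div_pos hq1 hp0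
  have hpc : p * c = q + 1 := by
    rw [hc]
    field_simp
  set w : M → ℝ := fun x => |u x| ^ p with hw
  have hw1 : ContMDiff (𝓡 N) 𝓘(ℝ, ℝ) 1 w := by
    have h1 : ContDiff ℝ 1 fun t : ℝ => |t| ^ p := contDiff_norm_rpow (E := ℝ) hp
    exact h1.contMDiff.comp hu1
  have hws : tsupport w ⊆ tsupport u := closure_mono fun x hx => by
    contrapose! hx
    simp only [Function.mem_support, not_not] at hx ⊢
    simp [hw, hx, hp0.ne']
  have hwc : HasCompactSupport w := hu_comp.of_isClosed_subset (isClosed_tsupport _) hws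
  have hw0 : ∀ x, 0 ≤ w x := fun x => Real.rpow_nonneg (abs_nonneg _) _
  obtain ⟨f, hf1, hfb, hfl, hfd, hft, hfdt⟩ := exists_contDiff_tendsto_rpow hq
  set G : ℝ → ℝ → M → ℝ := fun a b x =>
    ‖V x‖ ^ (p - 2) * (a * inner ℝ (V x) (riemannianGrad N w x) + w x * (b * ‖V x‖ ^ 2)) with hG
  have hkey : ∀ n, IntegrableOn (fun x => G (f n (ρ x)) (deriv (f n) (ρ x)) x) Ω μ ∧
      ∫ x in Ω, G (f n (ρ x)) (deriv (f n) (ρ x)) x ∂μ ≤ 0 := fun n => by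
    obtain ⟨L, hL⟩ := hfb n
    exact integral_chain_nonpos_manifold hp hΩ hρ0 hρW hsub (hf1 n) (fun t ht => (hfl n t ht).1)
      hL hw1 hwc (hws.trans hu_supp) hw0
  have hV1 : ∀ x, ‖V x‖ ^ (p - 2) * ‖V x‖ = ‖V x‖ ^ (p - 1) := fun x => by
    rcases (norm_nonneg (V x)).eq_or_lt with h | h
    · rw [← h, mul_zero, Real.zero_rpow (by linarith)]
    · rw [← Real.rpow_add_one h.ne']
      ring_nf
  have hV2 : ∀ x, ‖V x‖ ^ (p - 2) * ‖V x‖ ^ 2 = ‖V x‖ ^ p := fun x => by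
    rcases (norm_nonneg (V x)).eq_or_lt with h | h
    · rw [← h, zero_pow two_ne_zero, mul_zero, Real.zero_rpow hp0.ne']
    · rw [← Real.rpow_natCast, ← Real.rpow_add h]
      norm_num
  have hGeq : ∀ a b x, G a b x =
      a * (‖V x‖ ^ (p - 2) * inner ℝ (V x) (riemannianGrad N w x)) + b * (‖V x‖ ^ p * w x) :=
    fun a b x => by
      rw [← hV2 x]
      simp only [hG]
      ring
  have hI : ∀ x, |‖V x‖ ^ (p - 2) * inner ℝ (V x) (riemannianGrad N w x)| ≤
      ‖V x‖ ^ (p - 1) * (p * |u x| ^ (p - 1) * ‖riemannianGrad N u x‖) := fun x => by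
    have h1 := abs_inner_riemannianGrad_abs_rpow_le hp (hu1.mdifferentiable one_ne_zero x) (V x)
    have h0 := Real.rpow_nonneg (norm_nonneg (V x)) (p - 2)
    rw [abs_mul, abs_of_nonneg h0, ← hV1 x]
    refine (mul_le_mul_of_nonneg_left h1 h0).trans_eq ?_
    ring
  -- The Young bound of the cross term. It serves both as majorant in the limit `n → ∞` and in the
  -- final estimate.
  set Z : M → ℝ := fun x => (p - 1) * c * X x + c ^ (1 - p) * Y x with hZ
  have hZi : IntegrableOn Z Ω μ := (hXi.const_mul _).add (hYi.const_mul _)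
  have hcross : ∀ x a, 0 ≤ ρ x → 0 ≤ a → a ≤ ρ x ^ (q + 1) →
      |a * (‖V x‖ ^ (p - 2) * inner ℝ (V x) (riemannianGrad N w x))| ≤ Z x := by
    intro x a hx ha hle
    rw [abs_mul, abs_of_nonneg ha]
    refine (mul_le_mul hle (hI x) (abs_nonneg _) (ha.trans hle)).trans ?_
    exact hardy_young hp hq hx (norm_nonneg _) (abs_nonneg _) (norm_nonneg _) hc0
  have hXeq : ∀ x, ρ x ^ q * (‖V x‖ ^ p * w x) = X x := fun x => (mul_assoc _ _ _).symm
  have hlim := tendsto_integral_of_dominated_convergence (μ := μ.restrict Ω)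
    (F := fun n x => G (f n (ρ x)) (deriv (f n) (ρ x)) x)
    (f := fun x => G (ρ x ^ (q + 1)) ((q + 1) * ρ x ^ q) x)
    (fun x => Z x + (q + 1) * X x) (fun n => (hkey n).1.aestronglyMeasurable)
    (hZi.add (hXi.const_mul _)) (fun n => by
      filter_upwards [hρ0] with x hx
      rw [hGeq, Real.norm_eq_abs]
      refine (abs_add_le _ _).trans (add_le_add
        (hcross x _ hx (hfl n _ hx).1 (hfl n _ hx).2) ?_)
      have h0 : 0 ≤ ‖V x‖ ^ p * w x := mul_nonneg (Real.rpow_nonneg (norm_nonneg _) _) (hw0 x)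
      rw [abs_of_nonneg (mul_nonneg (hfd n _ hx).1 h0), ← hXeq x, ← mul_assoc (q + 1)]
      exact mul_le_mul_of_nonneg_right (hfd n _ hx).2 h0) (by
      filter_upwards [hρ0] with x hx
      simp only [hGeq]
      exact ((hft _ hx).mul_const _).add ((hfdt _ hx).mul_const _))
  have hle0 := le_of_tendsto' hlim fun n => (hkey n).2
  have hGi : IntegrableOn (fun x => G (ρ x ^ (q + 1)) ((q + 1) * ρ x ^ q) x) Ω μ := by
    have hm : AEStronglyMeasurable (fun x => G (ρ x ^ (q + 1)) ((q + 1) * ρ x ^ q) x)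
        (μ.restrict Ω) :=
      aestronglyMeasurable_of_tendsto_ae atTop (fun n => (hkey n).1.aestronglyMeasurable) (by
        filter_upwards [hρ0] with x hx
        simp only [hGeq]
        exact ((hft _ hx).mul_const _).add ((hfdt _ hx).mul_const _))
    refine Integrable.mono' (hZi.add (hXi.norm.const_mul (q + 1))) hm ?_
    filter_upwards [hρ0] with x hx
    rw [hGeq, mul_assoc (q + 1), hXeq, Real.norm_eq_abs]
    refine (abs_add_le _ _).trans (add_le_add
      (hcross x _ hx (Real.rpow_nonneg hx _) le_rfl) ?_)
    rw [abs_mul, abs_of_pos hq1]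
    rfl
  -- Almost everywhere on `Ω` the limit integrand is at least `p c X - Z = c X - c^(1-p) Y`.
  have hfin : ∫ x in Ω, (c * X x - c ^ (1 - p) * Y x) ∂μ ≤ 0 := by
    refine le_trans (integral_mono_ae ((hXi.const_mul _).sub (hYi.const_mul _)) hGi ?_) hle0
    filter_upwards [hρ0] with x hx
    rw [hGeq, mul_assoc (q + 1), hXeq]
    have h1 := neg_abs_le (ρ x ^ (q + 1) *
      (‖V x‖ ^ (p - 2) * inner ℝ (V x) (riemannianGrad N w x)))
    have h2 := hcross x _ hx (Real.rpow_nonneg hx _) le_rfl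
    have h4 : (q + 1) * X x = p * c * X x := by rw [hpc]
    simp only [hZ] at h2
    rw [h4]
    linarith
  rw [integral_sub (hXi.const_mul _) (hYi.const_mul _), integral_const_mul, integral_const_mul]
    at hfin
  have hcp : 0 < c ^ (p - 1) := Real.rpow_pos_of_pos hc0 _
  have e1 : c ^ (p - 1) * c = c ^ p := by
    rw [← Real.rpow_add_one hc0.ne']
    ring_nf
  have e2 : c ^ (p - 1) * c ^ (1 - p) = 1 := by
    rw [← Real.rpow_add hc0]
    norm_num
  have h3 := mul_le_mul_of_nonneg_left (sub_nonpos.1 hfin) hcp.le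
  rwa [← mul_assoc, ← mul_assoc, e1, e2, one_mul] at h3
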